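/- **Setting.** Let $x_1,x_2,\dots$ be independent random vectors in $\mathbb R^d$ with common density $p$. For a positive twice differentiable $q:\mathbb R^d\to\mathbb R$ put $$W(x,q)=-\|\nabla_x\log q(x)\|^2-2\,\Delta_x\log q(x).$$ A parametric model $M$ is a family of densities $p_{M(\theta)}$ on $\mathbb R^d$, $\theta\in\Theta\subseteq\mathbb R^{h}$, identified with the set $\{p_{M(\theta)}:\theta\in\Theta\}$ in inclusions. For a sample of size $n$ let $$GIC(M(\theta))=\frac1n\sum_{i=1}^n W(x_i,p_{M(\theta)}),$$ and let the maximum GIC estimator (MGICE) $\hat\theta=\hat\theta_n$ be a maximizer of $GIC(M(\theta))$ over $\theta\in\Theta$. Let $M_1\subsetneq M_2\subsetneq\dots\subsetneq M_K$ be strictly nested parametric models, $M_k$ with parameter space $\Theta_k\subseteq\mathbb R^{h_k}$ and MGICE $\hat\theta_k$, and let $k_0$ be the smallest $k$ such that $p\in M_k$. Every density $q$ in these models is assumed to be (1) twice differentiable on $\mathbb R^d$, (2) square-integrable together with its first and second partial derivatives, and (3) such that $q(x)\to0$ as $x_i\to\pm\infty$ with the other coordinates fixed, for each $i$. It is also assumed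 that $W(\cdot,p)$ is integrable with respect to $p$, i.e. that $E_p[W(x,p)]$ exists and is finite. For a model $M$ consider the following assumptions ($\|\cdot\|_F$ is the Frobenius norm). * (A4) $p=p_{M(\theta^*)}$ for some $\theta^*\in\Theta$, and $p_{M(\theta)}\ne p_{M(\theta^*)}$ for all $\theta\in\Theta$, $\theta\neq\theta^*$. * (A5) $p_{M(\theta)}(x)>0$ for all $\theta\in\Theta$ and all $x$. * (A6) $\Theta$ is compact. * (A7) There are functions $L_1,L_2$ with $E_p[L_1^2(x)]<\infty$ and $E_p[L_2^2(x)]<\infty$ such that for all $x$ and all $\theta_1,\theta_2\in\Theta$ $$\|\nabla_x^2\log p_{M(\theta_1)}(x)-\nabla_x^2\log p_{M(\theta_2)}(x)\|_F\le L_1(x)\|\theta_1-\theta_2\|,$$ $$\|s_{\theta_1}(x)s_{\theta_1}(x)^T-s_{\theta_2}(x)s_{\theta_2}(x)^T\|_F\le L_2(x)\|\theta_1-\theta_2\|,\qquad s_\theta=\nabla_x\log p_{M(\theta)}.$$ * (A8) There are a neighbourhood $U$ of $\theta^*$ in $\Theta$ and functions $M_{ij},N_{ij}$ on $\mathbb R^d$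 such that for all $i,j$ and $x$ the functions $\theta\mapsto\partial_i\partial_j\log p_{M(\theta)}(x)$ and $\theta\mapsto\partial_i\log p_{M(\theta)}(x)\,\partial_j\log p_{M(\theta)}(x)$ are twice differentiable on $U$, and for $\theta_1,\theta_2\in U$ their Hessians in $\theta$ at $\theta_1$ and $\theta_2$ differ in Frobenius norm by at most $M_{ij}(x)\|\theta_1-\theta_2\|$ and $N_{ij}(x)\|\theta_1-\theta_2\|$, respectively. **Theorem.** Suppose that 1. for every $k$ with $k_0\le k\le K$, the model $M_k$ satisfies (A4)–(A8), with true parameter $\theta_k^*$, and $\hat\theta_k$ is $\sqrt n$-consistent and asymptotically normal with invertible covariance matrix: $\sqrt n(\hat\theta_k-\theta_k^*)$ is bounded in probability and converges in distribution to $N(0,\Sigma_k)$ for some positive definite $\Sigma_k$; 2. for every $k$ with $1\le k<k_0$, the model $M_k$ satisfies (A6) and (A7); 3. the real numbers $C(n,k)$ satisfy $C(n,k)\to1$ as $n\to\infty$ for every $k$, and $n\log\{C(n,k_1)/C(n,k_2)\}\to-\infty$ as $n\to\infty$ whenever $K\ge k_1>k_2\ge1$. Let $MIC(k)=C(n,k)\,GIC(M_k(\hat\theta_k))$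 and let $\hat k=\hat k_n$ be any maximizer of $MIC(k)$ over $1\le k\le K$. Then $\hat k\to k_0$ in probability as $n\to\infty$. -/

import Mathlib

namespace MIC

open MeasureTheory ProbabilityTheory Filter Topology
open scoped Gradient Laplacian Matrix.Norms.Frobenius

/-- `ℝ^m` with its Euclidean norm. -/
abbrev Vec (m : ℕ) : Type := EuclideanSpace ℝ (Fin m)

noncomputable section

/-- The `i`-th standard basis vector of `ℝ^m`. -/
def e {m : ℕ} (i : Fin m) : Vec m := EuclideanSpace.single i 1

/-- The Hessian matrix `∂ᵢ ∂ⱼ f` of `f` at `x`. -/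
def hessian {m : ℕ} (f : Vec m → ℝ) (x : Vec m) : Matrix (Fin m) (Fin m) ℝ :=
  Matrix.of fun i j => fderiv ℝ (fderiv ℝ f) x (e i) (e j)

/-- The Hessian matrix at `x` of a function that matters only on `s` (the ordinary Hessian when
`x` is an interior point of `s`). -/
def hessianWithin {m : ℕ} (f : Vec m → ℝ) (s : Set (Vec m)) (x : Vec m) :
    Matrix (Fin m) (Fin m) ℝ :=
  Matrix.of fun i j => fderivWithin ℝ (fderivWithin ℝ f s) s x (e i) (e j)

/-- `log p`. -/
def logPDF {d : ℕ} (p : Vec d → ℝ) : Vec d → ℝ := fun x => Real.log (p x)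

/-- The score vector `∇ₓ log p (x)`. -/
def score {d : ℕ} (p : Vec d → ℝ) (x : Vec d) : Vec d := ∇ (logPDF p) x

/-- The objective function `W(x, p) = -‖∇ₓ log p(x)‖² - 2 Δₓ log p(x)`. -/
def W {d : ℕ} (p : Vec d → ℝ) (x : Vec d) : ℝ :=
  -‖score p x‖ ^ 2 - 2 * (Δ (logPDF p)) x

/-- The distribution on `ℝ^d` with density `p`. -/
def law {d : ℕ} (p : Vec d → ℝ) : Measure (Vec d) :=
  volume.withDensity fun x => ENNReal.ofReal (p x)

/-- A probability density function on `ℝ^d` which is twice differentiable, square-integrable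
together with its first and second derivatives, and tends to `0` along each coordinate. -/
structure IsRegularPDF {d : ℕ} (p : Vec d → ℝ) : Prop where
  nonneg : ∀ x, 0 ≤ p x
  lintegral_eq_one : ∫⁻ x, ENNReal.ofReal (p x) = 1
  differentiable : Differentiable ℝ p
  differentiable_fderiv : Differentiable ℝ (fderiv ℝ p)
  memLp : MemLp p 2 volume
  memLp_gradient : MemLp (∇ p) 2 volume
  memLp_hessian : ∀ i j, MemLp (fun x => hessian p x i j) 2 volume
  tendsto_atTop : ∀ (x : Vec d) (i : Fin d),
    Tendsto (fun t : ℝ => p (WithLp.toLp 2 (Function.update x.ofLp i t))) atTop (𝓝 0)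
  tendsto_atBot : ∀ (x : Vec d) (i : Fin d),
    Tendsto (fun t : ℝ => p (WithLp.toLp 2 (Function.update x.ofLp i t))) atBot (𝓝 0)

/-- A parametric model: a family `θ ↦ p_{M(θ)}` of functions on `ℝ^d`, with parameter `θ` in the
parameter space `Θ ⊆ ℝ^h`. Only the values of `pdf` on `Θ` are ever used. -/
structure ParametricModel (d : ℕ) where
  h : ℕ
  Θ : Set (Vec h)
  pdf : Vec h → Vec d → ℝ

namespace ParametricModel

variable {d : ℕ}

/-- The model as a set of densities, `{p_{M(θ)} : θ ∈ Θ}`. -/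
def densities (M : ParametricModel d) : Set (Vec d → ℝ) := M.pdf '' M.Θ

/-- Correct specification and identifiability: `p = p_{M(θ*)}` with `θ* ∈ Θ`, and
`p_{M(θ)} ≠ p_{M(θ*)}` for the other parameters. -/
def Identifiable (M : ParametricModel d) (p : Vec d → ℝ) (θstar : Vec M.h) : Prop :=
  θstar ∈ M.Θ ∧ M.pdf θstar = p ∧ ∀ θ ∈ M.Θ, θ ≠ θstar → M.pdf θ ≠ M.pdf θstar

/-- All densities of the model are strictly positive. -/
def Positive (M : ParametricModel d) : Prop :=
  ∀ θ ∈ M.Θ, ∀ x, 0 < M.pdf θ x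

/-- `∇ₓ² log p_{M(θ)}(x)` and `[∇ₓ log p_{M(θ)}(x)][∇ₓ log p_{M(θ)}(x)]ᵀ` are Lipschitz in `θ` for
the Frobenius norm, with Lipschitz constants `L₁(x)`, `L₂(x)` having finite second moments under
the data density `p`. -/
def LipschitzInParam (M : ParametricModel d) (p : Vec d → ℝ) : Prop :=
  ∃ L₁ L₂ : Vec d → ℝ, MemLp L₁ 2 (law p) ∧ MemLp L₂ 2 (law p) ∧
    ∀ x, ∀ θ₁ ∈ M.Θ, ∀ θ₂ ∈ M.Θ,
      ‖hessian (logPDF (M.pdf θ₁)) x - hessian (logPDF (M.pdf θ₂)) x‖ ≤ L₁ x * ‖θ₁ - θ₂‖ ∧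
      ‖Matrix.vecMulVec (score (M.pdf θ₁) x).ofLp (score (M.pdf θ₁) x).ofLp
          - Matrix.vecMulVec (score (M.pdf θ₂) x).ofLp (score (M.pdf θ₂) x).ofLp‖
        ≤ L₂ x * ‖θ₁ - θ₂‖

/-- For each `x`, the function `θ ↦ g θ x` on the parameter space `Θ ⊆ ℝ^h` is twice
differentiable at the points of `U ⊆ Θ`, and its Hessian is Lipschitz on `U` with constant `c x`
in Frobenius norm. -/
def HessianLipschitzOn {h : ℕ} (Θ U : Set (Vec h)) (g : Vec h → Vec d → ℝ) (c : Vec d → ℝ) :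
    Prop :=
  ∀ x,
    (∀ θ ∈ U, DifferentiableWithinAt ℝ (fun η => g η x) Θ θ ∧
      DifferentiableWithinAt ℝ (fderivWithin ℝ (fun η => g η x) Θ) Θ θ) ∧
    ∀ θ₁ ∈ U, ∀ θ₂ ∈ U,
      ‖hessianWithin (fun η => g η x) Θ θ₁ - hessianWithin (fun η => g η x) Θ θ₂‖
        ≤ c x * ‖θ₁ - θ₂‖

/-- For `θ` near `θ*` and all `i, j`, the second `θ`-derivatives of `∂ᵢ∂ⱼ log p_{M(θ)}(x)` and of
`∂ᵢ log p_{M(θ)}(x) ∂ⱼ log p_{M(θ)}(x)` exist and are Lipschitz in `θ`, with constants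
`Mᵢⱼ(x)` and `Nᵢⱼ(x)`. -/
def SmoothNear (M : ParametricModel d) (θstar : Vec M.h) : Prop :=
  ∃ U ∈ 𝓝[M.Θ] θstar, U ⊆ M.Θ ∧ ∃ Mc Nc : Fin d → Fin d → Vec d → ℝ, ∀ i j,
    HessianLipschitzOn M.Θ U (fun θ x => hessian (logPDF (M.pdf θ)) x i j) (Mc i j) ∧
    HessianLipschitzOn M.Θ U (fun θ x => score (M.pdf θ) x i * score (M.pdf θ) x j) (Nc i j)

variable {Ω : Type*}

/-- `GIC(M(θ)) = (1/n) ∑ᵢ W(xᵢ, p_{M(θ)})` for the first `n` observations of `X`. -/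
def gic (M : ParametricModel d) (X : ℕ → Ω → Vec d) (n : ℕ) (ω : Ω) (θ : Vec M.h) : ℝ :=
  (1 / (n : ℝ)) * ∑ i ∈ Finset.range n, W (M.pdf θ) (X i ω)

/-- `θhat n` is a maximum GIC estimator: a maximizer over `Θ` of `GIC(M(θ))`. -/
def IsMGICE (M : ParametricModel d) (X : ℕ → Ω → Vec d) (θhat : ℕ → Ω → Vec M.h) : Prop :=
  ∀ n ω, θhat n ω ∈ M.Θ ∧ IsMaxOn (M.gic X n ω) M.Θ (θhat n ω)

end ParametricModel

variable {Ω : Type*} [MeasurableSpace Ω]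

/-- `√n ‖θhat n - θ*‖` is bounded in probability. -/
def RootNConsistent {h : ℕ} (μ : Measure Ω) (θhat : ℕ → Ω → Vec h) (θstar : Vec h) : Prop :=
  ∀ ε : ENNReal, 0 < ε → ∃ B : ℝ,
    ∀ᶠ n : ℕ in atTop, μ {ω | B < √(n : ℝ) * ‖θhat n ω - θstar‖} ≤ ε

/-- `√n (θhat n - θ*)` converges in distribution to a centred normal law with invertible
covariance matrix. -/
def AsymptoticallyNormal {h : ℕ} (μ : Measure Ω) [IsProbabilityMeasure μ]
    (θhat : ℕ → Ω → Vec h) (θstar : Vec h) : Prop :=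
  ∃ S : Matrix (Fin h) (Fin h) ℝ, S.PosDef ∧
    TendstoInDistribution (fun (n : ℕ) ω => √(n : ℝ) • (θhat n ω - θstar)) atTop
      (id : Vec h → Vec h) (fun _ => μ) (multivariateGaussian 0 S)

/-- `MIC(k) = C(n,k) · GIC(M_k(θhat_k))`. -/
def mic {d K : ℕ} (M : Fin K → ParametricModel d) (X : ℕ → Ω → Vec d)
    (θhat : ∀ k, ℕ → Ω → Vec (M k).h) (C : ℕ → Fin K → ℝ) (n : ℕ) (ω : Ω) (k : Fin K) : ℝ :=
  C n k * (M k).gic X n ω (θhat k n ω)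

end

end MIC

namespace MIC

open MeasureTheory ProbabilityTheory Filter Topology
open scoped Gradient Laplacian Matrix.Norms.Frobenius

/-! ### The objective function in coordinates -/

lemma gradient_apply {d : ℕ} (f : Vec d → ℝ) (x : Vec d) (i : Fin d) :
    (∇ f x) i = fderiv ℝ f x (e i) := by
  have h : inner ℝ (∇ f x) (e i) = fderiv ℝ f x (e i) :=
    InnerProductSpace.toDual_symm_apply
  rw [← h, e, EuclideanSpace.inner_single_right]
  simp

lemma score_apply {d : ℕ} (q : Vec d → ℝ) (x : Vec d) (i : Fin d) :
    score q x i = fderiv ℝ (logPDF q) x (e i) := gradient_apply _ _ _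

lemma laplacian_eq_sum_hessian {d : ℕ} (f : Vec d → ℝ) (x : Vec d) :
    (Δ f) x = ∑ i, hessian f x i i := by
  rw [InnerProductSpace.laplacian_eq_iteratedFDeriv_orthonormalBasis f
    (EuclideanSpace.basisFun (Fin d) ℝ)]
  simp [iteratedFDeriv_two_apply, hessian, e]

lemma W_eq_sum {d : ℕ} (q : Vec d → ℝ) (x : Vec d) :
    W q x = ∑ i, (-(score q x i) ^ 2 - 2 * hessian (logPDF q) x i i) := by
  rw [W, laplacian_eq_sum_hessian, EuclideanSpace.norm_sq_eq, Finset.sum_sub_distrib,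
    ← Finset.mul_sum, Finset.sum_neg_distrib]
  simp

lemma measurable_W {d : ℕ} (q : Vec d → ℝ) : Measurable (W q) := by
  have h : W q = fun x => ∑ i, (-(fderiv ℝ (logPDF q) x (e i)) ^ 2
      - 2 * fderiv ℝ (fderiv ℝ (logPDF q)) x (e i) (e i)) := by
    ext x
    rw [W_eq_sum]
    simp only [score_apply, hessian, Matrix.of_apply]
  rw [h]
  refine Finset.measurable_sum _ fun i _ => ?_
  refine Measurable.sub ((measurable_fderiv_apply_const ℝ _ _).pow_const 2).neg
    (Measurable.const_mul ?_ 2)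
  exact (ContinuousLinearMap.measurable_apply (e i)).comp
    (measurable_fderiv_apply_const ℝ (fderiv ℝ (logPDF q)) (e i))

lemma W_one {d : ℕ} (x : Vec d) : W (fun _ => 1) x = 0 := by
  have h : logPDF (fun _ : Vec d => (1 : ℝ)) = fun _ => 0 := by
    ext; simp [logPDF]
  rw [W_eq_sum]
  simp [score_apply, h, hessian]

lemma norm_entry_le_frobenius {m : ℕ} (A : Matrix (Fin m) (Fin m) ℝ) (i j : Fin m) :
    |A i j| ≤ ‖A‖ := by
  rw [Matrix.frobenius_norm_def, ← Real.sqrt_eq_rpow]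
  apply Real.le_sqrt_of_sq_le
  simp only [Real.rpow_ofNat, Real.norm_eq_abs, sq_abs]
  calc A i j ^ 2 ≤ ∑ j, A i j ^ 2 :=
        Finset.single_le_sum (f := fun j => A i j ^ 2) (fun _ _ => sq_nonneg _)
          (Finset.mem_univ j)
    _ ≤ _ := Finset.single_le_sum (f := fun i => ∑ j, A i j ^ 2)
        (fun _ _ => Finset.sum_nonneg fun _ _ => sq_nonneg _) (Finset.mem_univ i)

lemma abs_W_sub_le {d : ℕ} (q₁ q₂ : Vec d → ℝ) (x : Vec d) {a b : ℝ}
    (ha : ‖hessian (logPDF q₁) x - hessian (logPDF q₂) x‖ ≤ a)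
    (hb : ‖Matrix.vecMulVec (score q₁ x).ofLp (score q₁ x).ofLp
          - Matrix.vecMulVec (score q₂ x).ofLp (score q₂ x).ofLp‖ ≤ b) :
    |W q₁ x - W q₂ x| ≤ d * (2 * a + b) := by
  rw [W_eq_sum, W_eq_sum, ← Finset.sum_sub_distrib]
  refine (Finset.abs_sum_le_sum_abs _ _).trans ?_
  have : ∀ i ∈ (Finset.univ : Finset (Fin d)),
      |(-(score q₁ x i) ^ 2 - 2 * hessian (logPDF q₁) x i i)
        - (-(score q₂ x i) ^ 2 - 2 * hessian (logPDF q₂) x i i)| ≤ 2 * a + b := by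
    intro i _
    have h1 := (norm_entry_le_frobenius _ i i).trans ha
    have h2 := (norm_entry_le_frobenius _ i i).trans hb
    simp only [Matrix.sub_apply, Matrix.vecMulVec_apply] at h1 h2
    rw [abs_le] at *
    constructor <;> nlinarith
  refine (Finset.sum_le_sum this).trans ?_
  rw [Finset.sum_const, Finset.card_univ, Fintype.card_fin, nsmul_eq_mul]

/-! ### Functions with a regular logarithm -/

/-- A positive function whose logarithm is twice differentiable, with locally integrable unmixed
second derivatives. -/
structure IsLogRegular {d : ℕ} (q : Vec d → ℝ) : Prop where
  pos : ∀ x, 0 < q x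
  differentiable : Differentiable ℝ (logPDF q)
  differentiable_fderiv : Differentiable ℝ (fderiv ℝ (logPDF q))
  locallyIntegrable : ∀ i, LocallyIntegrable (fun x => hessian (logPDF q) x i i)

lemma isLogRegular_one {d : ℕ} : IsLogRegular (fun _ : Vec d => (1 : ℝ)) := by
  have h : logPDF (fun _ : Vec d => (1 : ℝ)) = fun _ => 0 := by
    ext; simp [logPDF]
  refine ⟨fun _ => one_pos, ?_, ?_, fun i => ?_⟩
  · rw [h]; fun_prop
  · rw [h]; simp
  · simpa [h, hessian] using locallyIntegrable_zero

lemma IsRegularPDF.isLogRegular {d : ℕ} {q : Vec d → ℝ} (hq : IsRegularPDF q)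
    (hpos : ∀ x, 0 < q x) : IsLogRegular q := by
  have hne : ∀ x, q x ≠ 0 := fun x => (hpos x).ne'
  have hD : fderiv ℝ (logPDF q) = fun x => (q x)⁻¹ • fderiv ℝ q x := by
    ext1 x
    exact fderiv.log (hq.differentiable x) (hne x)
  have hinv : Differentiable ℝ fun x => (q x)⁻¹ := fun x => (hq.differentiable x).inv (hne x)
  have hDD : ∀ x i, hessian (logPDF q) x i i
      = (q x)⁻¹ * hessian q x i i - (q x)⁻¹ ^ 2 * (fderiv ℝ q x (e i)) ^ 2 := by
    intro x i
    have h1 : HasFDerivAt (fun x => (q x)⁻¹) (-((q x ^ 2)⁻¹) • fderiv ℝ q x) x := by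
      have := (hasDerivAt_inv (hne x)).comp_hasFDerivAt x (hq.differentiable x).hasFDerivAt
      exact this
    have h2 := h1.smul (hq.differentiable_fderiv x).hasFDerivAt
    have h3 := h2.fderiv
    simp only [hessian, Matrix.of_apply, hD]
    erw [h3]
    simp
    ring
  refine ⟨hpos, fun x => (hq.differentiable x).log (hne x), ?_, fun i => ?_⟩
  · rw [hD]
    exact hinv.smul hq.differentiable_fderiv
  · simp only [hDD]
    have hc := hq.differentiable_fderiv.continuous
    refine LocallyIntegrable.sub ?_ ?_
    · exact LocallyIntegrable.continuous_mul hinv.continuous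
        ((hq.memLp_hessian i i).locallyIntegrable one_le_two)
    · exact Continuous.locallyIntegrable
        ((hinv.continuous.pow 2).mul ((hc.clm_apply continuous_const).pow 2))

/-! ### Smooth cutoffs -/

lemma exists_cutoff (d : ℕ) : ∃ (C : ℝ) (φ : ℕ → Vec d → ℝ), ∀ n,
    ContDiff ℝ 1 (φ n) ∧ HasCompactSupport (φ n) ∧ (∀ x, 0 ≤ φ n x) ∧ (∀ x, φ n x ≤ 1) ∧
    (∀ x, ‖x‖ ≤ n + 1 → φ n x = 1) ∧ ∀ x i, |fderiv ℝ (φ n) x (e i)| ≤ C / (n + 1) := by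
  let ψ : ContDiffBump (0 : Vec d) := ⟨1, 2, one_pos, one_lt_two⟩
  have hψ : ContDiff ℝ 1 ψ := ψ.contDiff
  obtain ⟨C, hC⟩ := (ψ.hasCompactSupport.fderiv (𝕜 := ℝ)).exists_bound_of_continuous
    (hψ.continuous_fderiv (by norm_num))
  refine ⟨C, fun n x => ψ (((n : ℝ) + 1)⁻¹ • x), fun n => ?_⟩
  have hn : (0 : ℝ) < (n : ℝ) + 1 := by positivity
  refine ⟨hψ.comp (contDiff_const_smul _), ?_, fun x => ψ.nonneg, fun x => ψ.le_one, ?_, ?_⟩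
  · exact ψ.hasCompactSupport.comp_smul (inv_ne_zero hn.ne')
  · intro x hx
    apply ψ.one_of_mem_closedBall
    simp only [mem_closedBall_zero_iff, norm_smul, norm_inv, Real.norm_eq_abs, abs_of_pos hn, ψ]
    rw [inv_mul_le_iff₀ hn]
    simpa using hx
  · intro x i
    have h : fderiv ℝ (fun x => ψ (((n : ℝ) + 1)⁻¹ • x)) x
        = ((n : ℝ) + 1)⁻¹ • fderiv ℝ ψ (((n : ℝ) + 1)⁻¹ • x) :=
      fderiv_comp_smul _
    rw [h, smul_apply, smul_eq_mul, abs_mul, abs_of_pos (inv_pos.2 hn),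
      div_eq_inv_mul]
    gcongr
    refine ((fderiv ℝ ψ _).le_opNorm (e i)).trans ?_
    simpa [e] using hC _

/-! ### Fisher divergence -/

/-- Integral of a divergence term against the square of a cutoff. -/
lemma integral_cutoff_sq_mul_fderiv {d : ℕ} {φ v : Vec d → ℝ} (hφ : ContDiff ℝ 1 φ)
    (hφc : HasCompactSupport φ) (hv : Differentiable ℝ v) (i : Fin d)
    (hint : LocallyIntegrable (fun x => fderiv ℝ v x (e i))) :
    Integrable (fun x => φ x ^ 2 * fderiv ℝ v x (e i)) ∧
    Integrable (fun x => φ x * fderiv ℝ φ x (e i) * v x) ∧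
    ∫ x, φ x ^ 2 * fderiv ℝ v x (e i) = - (2 * ∫ x, φ x * fderiv ℝ φ x (e i) * v x) := by
  have hφ2 : ContDiff ℝ 1 (fun x => φ x ^ 2) := hφ.pow 2
  have hφ2c : HasCompactSupport (fun x => φ x ^ 2) :=
    hφc.comp_left (g := fun t : ℝ => t ^ 2) (by norm_num)
  have hdφ : Continuous fun x => fderiv ℝ φ x (e i) :=
    (hφ.continuous_fderiv (by norm_num)).clm_apply continuous_const
  have hd : ∀ x, fderiv ℝ (fun x => φ x ^ 2) x (e i) = 2 * (φ x * fderiv ℝ φ x (e i)) := by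
    intro x
    have := ((hφ.differentiable (by norm_num) x).hasFDerivAt.pow 2).fderiv
    rw [this]
    simp
    ring
  have h1 : Integrable (fun x => φ x ^ 2 * fderiv ℝ v x (e i)) := by
    simpa using hint.integrable_smul_left_of_hasCompactSupport hφ2.continuous hφ2c
  have h2 : Integrable (fun x => φ x * fderiv ℝ φ x (e i) * v x) := by
    refine Continuous.integrable_of_hasCompactSupport
      ((hφ.continuous.mul hdφ).mul hv.continuous) ?_
    exact (hφc.mul_right (f' := fun x => fderiv ℝ φ x (e i))).mul_right (f' := v)
  have h3 : Integrable (fun x => φ x ^ 2 * v x) :=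
    Continuous.integrable_of_hasCompactSupport (hφ2.continuous.mul hv.continuous)
      (hφ2c.mul_right (f' := v))
  refine ⟨h1, h2, ?_⟩
  have h := integral_mul_fderiv_eq_neg_fderiv_mul_of_integrable (𝕜 := ℝ) (μ := volume)
    (f := fun x => φ x ^ 2) (g := v) (v := e i) ?_ h1 h3
      (fun x _ => hφ2.differentiable (by norm_num) x) (fun x _ => hv x)
  · rw [h, ← integral_const_mul]
    simp only [hd]
    congr 2
    ext x; ring
  · simp only [hd]
    convert h2.const_mul 2 using 2
    ring

lemma IsLogRegular.eq_exp {d : ℕ} {p : Vec d → ℝ} (hp : IsLogRegular p) :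
    p = fun x => Real.exp (logPDF p x) := by
  ext x
  rw [logPDF, Real.exp_log (hp.pos x)]

lemma IsLogRegular.differentiable_self {d : ℕ} {p : Vec d → ℝ} (hp : IsLogRegular p) :
    Differentiable ℝ p := by
  rw [hp.eq_exp]
  exact hp.differentiable.exp

lemma IsLogRegular.fderiv_self {d : ℕ} {p : Vec d → ℝ} (hp : IsLogRegular p) (x v : Vec d) :
    fderiv ℝ p x v = p x * fderiv ℝ (logPDF p) x v := by
  have h : fderiv ℝ p x = Real.exp (logPDF p x) • fderiv ℝ (logPDF p) x := by
    conv_lhs => rw [hp.eq_exp]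
    exact (hp.differentiable x).hasFDerivAt.exp.fderiv
  rw [h, logPDF, Real.exp_log (hp.pos x)]
  rfl

lemma IsLogRegular.continuous_score {d : ℕ} {p : Vec d → ℝ} (hp : IsLogRegular p) (i : Fin d) :
    Continuous fun x => score p x i := by
  simp only [score_apply]
  exact hp.differentiable_fderiv.continuous.clm_apply continuous_const

lemma IsLogRegular.hasFDerivAt_score {d : ℕ} {p : Vec d → ℝ} (hp : IsLogRegular p) (i : Fin d)
    (x : Vec d) : ∃ D : Vec d →L[ℝ] ℝ, HasFDerivAt (fun x => score p x i) D x ∧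
      ∀ j, D (e j) = hessian (logPDF p) x j i := by
  simp only [score_apply]
  refine ⟨_, (hp.differentiable_fderiv x).hasFDerivAt.clm_apply (hasFDerivAt_const (e i) x), ?_⟩
  intro j
  simp [hessian]

lemma IsLogRegular.fderiv_mul_score_sub {d : ℕ} {p q : Vec d → ℝ} (hp : IsLogRegular p)
    (hq : IsLogRegular q) (i : Fin d) :
    Differentiable ℝ (fun x => p x * (score p x i - score q x i)) ∧
    ∀ x, fderiv ℝ (fun x => p x * (score p x i - score q x i)) x (e i)
      = p x * (score p x i * (score p x i - score q x i))
        + p x * (hessian (logPDF p) x i i - hessian (logPDF q) x i i) := by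
  have key : ∀ x, ∃ D : Vec d →L[ℝ] ℝ,
      HasFDerivAt (fun x => p x * (score p x i - score q x i)) D x ∧
      D (e i) = p x * (score p x i * (score p x i - score q x i))
        + p x * (hessian (logPDF p) x i i - hessian (logPDF q) x i i) := by
    intro x
    obtain ⟨Dp, hDp, hDp'⟩ := hp.hasFDerivAt_score i x
    obtain ⟨Dq, hDq, hDq'⟩ := hq.hasFDerivAt_score i x
    refine ⟨_, (hp.differentiable_self x).hasFDerivAt.mul (hDp.sub hDq), ?_⟩
    simp only [add_apply, smul_apply, sub_apply, hDp', hDq', hp.fderiv_self, score_apply,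
      smul_eq_mul]
    ring
  refine ⟨fun x => (key x).choose_spec.1.differentiableAt, fun x => ?_⟩
  obtain ⟨D, hD, hD'⟩ := key x
  rw [hD.fderiv, hD']

/-- The difference of the objective functions at `p` and `q`, weighted by `p`, is the Fisher
divergence density up to an exact divergence. -/
lemma IsLogRegular.mul_W_sub {d : ℕ} {p q : Vec d → ℝ} (hp : IsLogRegular p)
    (hq : IsLogRegular q) (x : Vec d) :
    p x * (W p x - W q x) = ∑ i, (p x * (score p x i - score q x i) ^ 2
      - 2 * fderiv ℝ (fun x => p x * (score p x i - score q x i)) x (e i)) := by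
  rw [W_eq_sum, W_eq_sum, ← Finset.sum_sub_distrib, Finset.mul_sum]
  refine Finset.sum_congr rfl fun i _ => ?_
  rw [(hp.fderiv_mul_score_sub hq i).2]
  ring

lemma IsLogRegular.half_integral_closedBall_le {d : ℕ} {p q : Vec d → ℝ} (hp : IsLogRegular p)
    (hq : IsLogRegular q) (hpi : Integrable p)
    (hW : Integrable fun x => p x * (W p x - W q x)) (r : ℝ) :
    (1 / 2) * ∫ x in Metric.closedBall 0 r, p x * ∑ i, (score p x i - score q x i) ^ 2
      ≤ ∫ x, p x * (W p x - W q x) := by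
  obtain ⟨C, φ, hφ⟩ := exists_cutoff d
  have hpc : Continuous p := hp.differentiable_self.continuous
  have huc : ∀ i, Continuous fun x => score p x i - score q x i :=
    fun i => (hp.continuous_score i).sub (hq.continuous_score i)
  set F : Vec d → ℝ := fun x => p x * ∑ i, (score p x i - score q x i) ^ 2 with hF
  have hFc : Continuous F := hpc.mul (continuous_finsetSum _ fun i _ => (huc i).pow 2)
  have hF0 : ∀ x, 0 ≤ F x := fun x =>
    mul_nonneg (hp.pos x).le (Finset.sum_nonneg fun _ _ => sq_nonneg _)
  have hloc : ∀ i, LocallyIntegrable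
      (fun x => fderiv ℝ (fun x => p x * (score p x i - score q x i)) x (e i)) := by
    intro i
    simp only [(hp.fderiv_mul_score_sub hq i).2]
    refine LocallyIntegrable.add ?_ ?_
    · exact Continuous.locallyIntegrable
        (hpc.mul ((hp.continuous_score i).mul (huc i)))
    · exact LocallyIntegrable.continuous_mul hpc
        ((hp.locallyIntegrable i).sub (hq.locallyIntegrable i))
  have step : ∀ n : ℕ, r ≤ n →
      (1 / 2) * ∫ x in Metric.closedBall 0 r, F x
        ≤ (∫ x, φ n x ^ 2 * (p x * (W p x - W q x)))
          + 8 * d * (C / (n + 1)) ^ 2 * ∫ x, p x := by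
    intro n hn
    obtain ⟨hφ1, hφc, hφ0, hφle, hφone, hφd⟩ := hφ n
    have hφ2c : HasCompactSupport (fun x => φ n x ^ 2) :=
      hφc.comp_left (g := fun t : ℝ => t ^ 2) (by norm_num)
    have hIF : Integrable fun x => φ n x ^ 2 * F x :=
      Continuous.integrable_of_hasCompactSupport ((hφ1.continuous.pow 2).mul hFc)
        (hφ2c.mul_right (f' := F))
    have hA := fun i => integral_cutoff_sq_mul_fderiv hφ1 hφc
      (hp.fderiv_mul_score_sub hq i).1 i (hloc i)
    have hIW : ∫ x, φ n x ^ 2 * (p x * (W p x - W q x))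
        = (∫ x, φ n x ^ 2 * F x)
          + ∫ x, ∑ i, 4 * (φ n x * fderiv ℝ (φ n) x (e i)
              * (p x * (score p x i - score q x i))) := by
      have : ∀ x, φ n x ^ 2 * (p x * (W p x - W q x)) = φ n x ^ 2 * F x
          - ∑ i, 2 * (φ n x ^ 2
            * fderiv ℝ (fun x => p x * (score p x i - score q x i)) x (e i)) := by
        intro x
        rw [hp.mul_W_sub hq]
        simp only [hF]
        rw [Finset.mul_sum, Finset.mul_sum, Finset.mul_sum, ← Finset.sum_sub_distrib]
        exact Finset.sum_congr rfl fun i _ => by ring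
      simp only [this]
      rw [integral_sub hIF (integrable_finsetSum _ fun i _ => (hA i).1.const_mul 2),
        integral_finsetSum _ fun i _ => (hA i).1.const_mul 2,
        integral_finsetSum _ fun i _ => (hA i).2.1.const_mul 4, sub_eq_add_neg,
        ← Finset.sum_neg_distrib]
      congr 1
      refine Finset.sum_congr rfl fun i _ => ?_
      rw [integral_const_mul, integral_const_mul, (hA i).2.2]
      ring
    have hcross : -((1 / 2) * ∫ x, φ n x ^ 2 * F x) - 8 * d * (C / (n + 1)) ^ 2 * ∫ x, p x
        ≤ ∫ x, ∑ i, 4 * (φ n x * fderiv ℝ (φ n) x (e i)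
              * (p x * (score p x i - score q x i))) := by
      have hneg : Integrable fun x => -((1 / 2) * (φ n x ^ 2 * F x)) := (hIF.const_mul _).neg
      rw [← integral_const_mul, ← integral_const_mul, ← integral_neg,
        ← integral_sub hneg (hpi.const_mul _)]
      refine integral_mono (hneg.sub (hpi.const_mul _))
        (integrable_finsetSum _ fun i _ => (hA i).2.1.const_mul 4) fun x => ?_
      have : -((1 / 2) * (φ n x ^ 2 * F x)) - 8 * d * (C / (n + 1)) ^ 2 * p x
          = ∑ i : Fin d, (-((1 / 2) * (φ n x ^ 2 * (p x * (score p x i - score q x i) ^ 2)))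
            - 8 * (C / (n + 1)) ^ 2 * p x) := by
        rw [Finset.sum_sub_distrib, Finset.sum_neg_distrib, Finset.sum_const, Finset.card_univ,
          Fintype.card_fin, nsmul_eq_mul, ← Finset.mul_sum, ← Finset.mul_sum, ← Finset.mul_sum]
        ring
      simp only [this]
      refine Finset.sum_le_sum fun i _ => ?_
      have h1 : (fderiv ℝ (φ n) x (e i)) ^ 2 ≤ (C / (n + 1)) ^ 2 := by
        rw [← sq_abs]
        exact pow_le_pow_left₀ (abs_nonneg _) (hφd x i) 2
      have h2 := mul_le_mul_of_nonneg_right h1 (hp.pos x).le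
      have h3 := mul_nonneg (hp.pos x).le (sq_nonneg
        (φ n x * (score p x i - score q x i) + 4 * fderiv ℝ (φ n) x (e i)))
      nlinarith
    have hmono : ∫ x in Metric.closedBall 0 r, F x ≤ ∫ x, φ n x ^ 2 * F x := by
      rw [← integral_indicator Metric.isClosed_closedBall.measurableSet]
      refine integral_mono ?_ hIF fun x => ?_
      · exact (hFc.continuousOn.integrableOn_compact (isCompact_closedBall 0 r)).integrable_indicator
          Metric.isClosed_closedBall.measurableSet
      · by_cases hx : x ∈ Metric.closedBall (0 : Vec d) r
        · have : ‖x‖ ≤ n + 1 := by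
            have := mem_closedBall_zero_iff.1 hx
            linarith
          simp [hx, hφone x this]
        · simpa [hx] using mul_nonneg (sq_nonneg (φ n x)) (hF0 x)
    linarith
  have hlim1 : Tendsto (fun n => ∫ x, φ n x ^ 2 * (p x * (W p x - W q x))) atTop
      (𝓝 (∫ x, p x * (W p x - W q x))) := by
    refine tendsto_integral_of_dominated_convergence (fun x => |p x * (W p x - W q x)|)
      (fun n => ?_) hW.abs (fun n => ?_) ?_
    · exact ((hφ n).1.continuous.pow 2).aestronglyMeasurable.mul hW.1
    · refine Eventually.of_forall fun x => ?_
      rw [norm_mul, Real.norm_eq_abs, Real.norm_eq_abs]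
      refine mul_le_of_le_one_left (abs_nonneg _) ?_
      rw [abs_of_nonneg (sq_nonneg _)]
      exact pow_le_one₀ ((hφ n).2.2.1 x) ((hφ n).2.2.2.1 x)
    · refine Eventually.of_forall fun x => tendsto_const_nhds.congr' ?_
      filter_upwards [eventually_ge_atTop ⌈‖x‖⌉₊] with n hn
      have : ‖x‖ ≤ n + 1 := (Nat.ceil_le.1 hn).trans (by linarith)
      rw [(hφ n).2.2.2.2.1 x this]
      ring
  have hlim2 : Tendsto (fun n : ℕ => 8 * d * (C / ((n : ℝ) + 1)) ^ 2 * ∫ x, p x) atTop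
      (𝓝 (8 * d * 0 ^ 2 * ∫ x, p x)) := by
    refine ((Tendsto.pow ?_ 2).const_mul _).mul_const _
    have := (tendsto_one_div_add_atTop_nhds_zero_nat (𝕜 := ℝ)).const_mul C
    simpa [div_eq_mul_inv] using this
  have hlim := hlim1.add hlim2
  simp only [ne_eq, OfNat.ofNat_ne_zero, not_false_eq_true, zero_pow, mul_zero, zero_mul,
    add_zero] at hlim
  refine ge_of_tendsto hlim ?_
  filter_upwards [eventually_ge_atTop ⌈r⌉₊] with n hn
  exact step n (Nat.ceil_le.1 hn)

lemma IsLogRegular.integral_mul_W_sub_nonneg {d : ℕ} {p q : Vec d → ℝ} (hp : IsLogRegular p)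
    (hq : IsLogRegular q) (hpi : Integrable p)
    (hW : Integrable fun x => p x * (W p x - W q x)) :
    0 ≤ ∫ x, p x * (W p x - W q x) := by
  refine le_trans ?_ (hp.half_integral_closedBall_le hq hpi hW 0)
  refine mul_nonneg (by norm_num) (integral_nonneg fun x => ?_)
  exact mul_nonneg (hp.pos x).le (Finset.sum_nonneg fun _ _ => sq_nonneg _)

/-- If the Fisher divergence vanishes, then the two functions are proportional. -/
lemma IsLogRegular.exists_eq_const_mul {d : ℕ} {p q : Vec d → ℝ} (hp : IsLogRegular p)
    (hq : IsLogRegular q) (hpi : Integrable p)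
    (hW : Integrable fun x => p x * (W p x - W q x))
    (h0 : ∫ x, p x * (W p x - W q x) ≤ 0) : ∃ c : ℝ, ∀ x, p x = c * q x := by
  have hpc : Continuous p := hp.differentiable_self.continuous
  set F : Vec d → ℝ := fun x => p x * ∑ i, (score p x i - score q x i) ^ 2 with hF
  have hFc : Continuous F := hpc.mul (continuous_finsetSum _ fun i _ =>
    ((hp.continuous_score i).sub (hq.continuous_score i)).pow 2)
  have hF0 : ∀ x, 0 ≤ F x := fun x =>
    mul_nonneg (hp.pos x).le (Finset.sum_nonneg fun _ _ => sq_nonneg _)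
  have hzero : ∀ x, F x = 0 := by
    intro x
    by_contra hx
    have hxpos : 0 < F x := lt_of_le_of_ne (hF0 x) (Ne.symm hx)
    have h1 := hp.half_integral_closedBall_le hq hpi hW (‖x‖ + 1)
    have h2 : 0 < ∫ y in Metric.closedBall 0 (‖x‖ + 1), F y := by
      rw [setIntegral_pos_iff_support_of_nonneg_ae (Eventually.of_forall hF0)
        (hFc.continuousOn.integrableOn_compact (isCompact_closedBall 0 _))]
      have hopen : IsOpen (Function.support F ∩ Metric.ball 0 (‖x‖ + 1)) :=
        (hFc.isOpen_support).inter Metric.isOpen_ball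
      refine (hopen.measure_pos volume ⟨x, hx, by simp⟩).trans_le (measure_mono ?_)
      exact Set.inter_subset_inter_right _ Metric.ball_subset_closedBall
    linarith
  have hscore : ∀ x i, score p x i = score q x i := by
    intro x i
    have h1 : ∑ i, (score p x i - score q x i) ^ 2 = 0 :=
      (mul_eq_zero.1 (hzero x)).resolve_left (hp.pos x).ne'
    have h2 := (Finset.sum_eq_zero_iff_of_nonneg fun _ _ => sq_nonneg _).1 h1 i
      (Finset.mem_univ i)
    linarith [pow_eq_zero_iff two_ne_zero |>.1 h2]
  have hgrad : ∀ x, fderiv ℝ (fun x => logPDF p x - logPDF q x) x = 0 := by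
    intro x
    have h1 : score p x = score q x := by ext i; exact hscore x i
    have h2 : fderiv ℝ (logPDF p) x = fderiv ℝ (logPDF q) x :=
      (InnerProductSpace.toDual ℝ (Vec d)).symm.injective h1
    rw [fderiv_fun_sub (hp.differentiable x) (hq.differentiable x), h2, sub_self]
  have hconst := is_const_of_fderiv_eq_zero (𝕜 := ℝ) (hp.differentiable.sub hq.differentiable) hgrad
  refine ⟨Real.exp (logPDF p 0 - logPDF q 0), fun x => ?_⟩
  have h1 := hconst x 0
  simp only [Pi.sub_apply] at h1
  rw [← h1, Real.exp_sub, logPDF, logPDF, Real.exp_log (hp.pos x), Real.exp_log (hq.pos x)]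
  field_simp [(hq.pos x).ne']

/-! ### Finite nets in Euclidean space -/

lemma abs_sub_le_of_floor_eq {s x y : ℝ} (hs : 0 < s) (h : ⌊x / s⌋ = ⌊y / s⌋) : |x - y| ≤ s := by
  have h1 := Int.abs_sub_lt_one_of_floor_eq_floor h
  rw [← sub_div, abs_div, abs_of_pos hs, div_lt_one hs] at h1
  exact h1.le

lemma floor_div_mem_Icc {r x : ℝ} (hr : 0 < r) (hx : |x| ≤ r) (j : ℕ) :
    ⌊x / (r / 2 ^ j)⌋ ∈ Finset.Icc (-(2 ^ j : ℕ) : ℤ) ((2 ^ j : ℕ) : ℤ) := by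
  have hs : 0 < r / 2 ^ j := by positivity
  obtain ⟨h1, h2⟩ := abs_le.1 hx
  rw [Finset.mem_Icc]
  constructor
  · rw [Int.le_floor, le_div_iff₀ hs]
    push_cast
    calc -(2 : ℝ) ^ j * (r / 2 ^ j) = -r := by field_simp
      _ ≤ x := h1
  · have : x / (r / 2 ^ j) ≤ 2 ^ j := by
      rw [div_le_iff₀ hs]
      calc x ≤ r := h2
        _ = 2 ^ j * (r / 2 ^ j) := by field_simp
    have h3 := (Int.floor_le (x / (r / 2 ^ j))).trans this
    exact_mod_cast h3

lemma norm_le_of_forall_abs_le {h : ℕ} (x : Vec h) {s : ℝ} (hx : ∀ i, |x i| ≤ s) :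
    ‖x‖ ≤ h * s := by
  have h1 : x = ∑ i, x i • e i := by
    ext j
    simp [e, Finset.sum_apply, Pi.single_apply]
  calc ‖x‖ = ‖∑ i, x i • e i‖ := by rw [← h1]
    _ ≤ ∑ i, ‖x i • e i‖ := norm_sum_le _ _
    _ ≤ ∑ _i : Fin h, s := Finset.sum_le_sum fun i _ => by simpa [norm_smul, e] using hx i
    _ = h * s := by simp

/-- A subset of a ball of radius `r` has dyadic nets of polynomial cardinality. -/
lemma exists_net {h : ℕ} {T : Set (Vec h)} {a : Vec h} {r : ℝ} (hr : 0 < r)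
    (hT : ∀ θ ∈ T, ‖θ - a‖ ≤ r) (j : ℕ) :
    ∃ N : Finset (Vec h), ↑N ⊆ T ∧ N.card ≤ (3 * 2 ^ j) ^ h ∧
      ∀ θ ∈ T, ∃ s ∈ N, ‖s - θ‖ ≤ (h + 1) * (r / 2 ^ j) := by
  classical
  have hs : 0 < r / 2 ^ j := by positivity
  let κ : Vec h → Fin h → ℤ := fun θ i => ⌊(θ i - a i) / (r / 2 ^ j)⌋
  let I : Finset (Fin h → ℤ) :=
    Fintype.piFinset fun _ => Finset.Icc (-(2 ^ j : ℕ) : ℤ) ((2 ^ j : ℕ) : ℤ)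
  have hκ : ∀ θ ∈ T, κ θ ∈ I := fun θ hθ => Fintype.mem_piFinset.2 fun i =>
    floor_div_mem_Icc hr ((PiLp.norm_apply_le (θ - a) i).trans (hT θ hθ)) j
  have hcard : I.card ≤ (3 * 2 ^ j) ^ h := by
    rw [Fintype.card_piFinset, Finset.prod_const, Finset.card_univ, Fintype.card_fin, Int.card_Icc]
    refine Nat.pow_le_pow_left ?_ h
    have : 1 ≤ 2 ^ j := Nat.one_le_two_pow
    omega
  have hchoice : ∀ k : Fin h → ℤ, ∃ t : Vec h, (∃ θ ∈ T, κ θ = k) → t ∈ T ∧ κ t = k := by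
    intro k
    by_cases hk : ∃ θ ∈ T, κ θ = k
    · obtain ⟨θ, hθ, hk⟩ := hk
      exact ⟨θ, fun _ => ⟨hθ, hk⟩⟩
    · exact ⟨0, fun h => absurd h hk⟩
  choose t ht using hchoice
  refine ⟨(I.filter fun k => ∃ θ ∈ T, κ θ = k).image t, ?_, ?_, ?_⟩
  · intro x hx
    simp only [Finset.coe_image, Set.mem_image, Finset.mem_coe, Finset.mem_filter] at hx
    obtain ⟨k, ⟨_, hk⟩, rfl⟩ := hx
    exact (ht k hk).1
  · exact Finset.card_image_le.trans ((Finset.card_filter_le _ _).trans hcard)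
  · intro θ hθ
    have hθ' := ht (κ θ) ⟨θ, hθ, rfl⟩
    refine ⟨t (κ θ), Finset.mem_image_of_mem _ (Finset.mem_filter.2 ⟨hκ θ hθ, θ, hθ, rfl⟩), ?_⟩
    have h1 : ‖t (κ θ) - θ‖ ≤ h * (r / 2 ^ j) := by
      refine norm_le_of_forall_abs_le _ fun i => ?_
      have := abs_sub_le_of_floor_eq hs (congrFun hθ'.2 i)
      simpa using this
    exact h1.trans (by gcongr; linarith)

/-! ### Chaining -/

lemma exists_chaining_thresholds (h : ℕ) (v : ℝ) {ε : ENNReal} (hε : 0 < ε) :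
    ∃ u : ℕ → ℝ, Summable (fun j => u j * ((2 * (h + 1)) / 2 ^ j)) ∧ (∀ j, 0 ≤ u j) ∧
      ∑' j, (((3 * 2 ^ j) ^ h * (3 * 2 ^ (j + 1)) ^ h : ℕ) : ENNReal)
        * ENNReal.ofReal (2 * Real.exp (v - u j)) ≤ ε := by
  set c : ℝ := 18 ^ h * 2 * Real.exp v with hc
  set l : ℝ := Real.log (4 ^ h * 2) with hl
  have hl0 : 0 ≤ l := Real.log_nonneg (by
    have : (1 : ℝ) ≤ 4 ^ h := one_le_pow₀ (by norm_num)
    linarith)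
  have hlim : Tendsto (fun a : ℝ => ENNReal.ofReal (2 * c * Real.exp (-a))) atTop (𝓝 0) := by
    have := (Real.tendsto_exp_neg_atTop_nhds_zero).const_mul (2 * c)
    rw [mul_zero] at this
    simpa using ENNReal.tendsto_ofReal this
  obtain ⟨a, ha, ha0⟩ := ((hlim.eventually (gt_mem_nhds hε)).and (eventually_ge_atTop 0)).exists
  refine ⟨fun j => a + j * l, ?_, fun j => by positivity, ?_⟩
  · have h1 : Summable fun j : ℕ => ((1 : ℝ) / 2) ^ j := summable_geometric_two
    have h2 : Summable fun j : ℕ => (j : ℝ) * ((1 : ℝ) / 2) ^ j := by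
      simpa using summable_pow_mul_geometric_of_norm_lt_one (R := ℝ) 1
        (r := 1 / 2) (by norm_num)
    refine ((h1.mul_left (a * (2 * (h + 1)))).add (h2.mul_left (l * (2 * (h + 1))))).congr ?_
    intro j
    rw [one_div, inv_pow]
    ring
  · have hterm : ∀ j : ℕ, (((3 * 2 ^ j) ^ h * (3 * 2 ^ (j + 1)) ^ h : ℕ) : ENNReal)
        * ENNReal.ofReal (2 * Real.exp (v - (a + j * l)))
        = ENNReal.ofReal (c * Real.exp (-a) * (1 / 2) ^ j) := by
      intro j
      rw [← ENNReal.ofReal_natCast, ← ENNReal.ofReal_mul (Nat.cast_nonneg _)]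
      congr 1
      have e1 : Real.exp (v - (a + j * l)) = Real.exp v * Real.exp (-a) * ((4 ^ h * 2) ^ j)⁻¹ := by
        rw [show v - (a + j * l) = v + -a + -(j * l) by ring, Real.exp_add, Real.exp_add,
          Real.exp_neg (j * l), Real.exp_nat_mul, hl, Real.exp_log (by positivity)]
      rw [e1, hc]
      push_cast
      have e2 : ((3 * 2 ^ j) ^ h * (3 * 2 ^ (j + 1)) ^ h : ℝ) = 18 ^ h * (4 ^ h) ^ j := by
        rw [← mul_pow, ← pow_mul, mul_comm h j, pow_mul, ← mul_pow]
        congr 1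
        rw [pow_succ, show (4 : ℝ) = 2 * 2 by norm_num, mul_pow]
        ring
      rw [e2, mul_pow, one_div, inv_pow]
      field_simp
    simp only [hterm]
    have hc0 : 0 ≤ c * Real.exp (-a) := by positivity
    rw [← ENNReal.ofReal_tsum_of_nonneg (fun j => by positivity)
      (summable_geometric_two.mul_left _), tsum_mul_left, tsum_geometric_two,
      show c * Real.exp (-a) * 2 = 2 * c * Real.exp (-a) by ring]
    exact ha.le

/-- Chaining bound: a process with exponential increment tails, indexed by a bounded subset of
`ℝ^h`, is bounded in probability by a constant depending only on the dimension and the tails. -/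
lemma exists_chaining_bound {Ω : Type*} [MeasurableSpace Ω] (μ : Measure Ω) (h : ℕ) (v : ℝ)
    {ε : ENNReal} (hε : 0 < ε) :
    ∃ A : ℝ, ∀ (T : Set (Vec h)) (a : Vec h) (r κ : ℝ) (Y : Vec h → Ω → ℝ), 0 < r → 0 ≤ κ →
      a ∈ T → (∀ θ ∈ T, ‖θ - a‖ ≤ r) →
      (∀ s ∈ T, ∀ t ∈ T, ∀ ρ : ℝ, 0 < ρ → ‖s - t‖ ≤ ρ * r → ∀ u : ℝ,
        μ {ω | u * (κ * ρ) ≤ |Y s ω - Y t ω|} ≤ ENNReal.ofReal (2 * Real.exp (v - u))) →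
      (∀ᵐ ω ∂μ, ∃ R : ℝ, ∀ s ∈ T, ∀ t ∈ T, |Y s ω - Y t ω| ≤ R * ‖s - t‖) →
      μ {ω | ∃ θ ∈ T, κ * A < |Y θ ω - Y a ω|} ≤ ε := by
  classical
  obtain ⟨u, hsum, hu0, hu⟩ := exists_chaining_thresholds h v hε
  refine ⟨∑' j, u j * ((2 * (h + 1)) / 2 ^ j), ?_⟩
  intro T a r κ Y hr hκ haT hT htail hcont
  have hnet : ∀ j, ∃ N : Finset (Vec h), ↑N ⊆ T ∧ N.card ≤ (3 * 2 ^ j) ^ h ∧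
      (∀ θ ∈ T, ∃ s ∈ N, ‖s - θ‖ ≤ (h + 1) * (r / 2 ^ j)) ∧ (j = 0 → N = {a}) := by
    intro j
    rcases Nat.eq_zero_or_pos j with rfl | hj
    · refine ⟨{a}, by simpa using haT, by simpa using Nat.one_le_pow _ _ (by norm_num),
        fun θ hθ => ⟨a, by simp, ?_⟩, fun _ => rfl⟩
      rw [norm_sub_rev]
      refine (hT θ hθ).trans ?_
      have : 0 ≤ (h : ℝ) * r := by positivity
      simp only [pow_zero, div_one]
      linarith
    · obtain ⟨N, h1, h2, h3⟩ := exists_net hr hT j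
      exact ⟨N, h1, h2, h3, fun h => absurd h hj.ne'⟩
  choose N hNT hNcard hNnet hN0 using hnet
  set ρ : ℕ → ℝ := fun j => (2 * (h + 1)) / 2 ^ j with hρ
  have hρpos : ∀ j, 0 < ρ j := fun j => by simp only [hρ]; positivity
  let bad : ℕ → Set Ω := fun j => ⋃ z ∈ (N j ×ˢ N (j + 1)).filter fun z => ‖z.2 - z.1‖ ≤ ρ j * r,
    {ω | u j * (κ * ρ j) ≤ |Y z.2 ω - Y z.1 ω|}
  have hbad : ∀ j, μ (bad j) ≤ (((3 * 2 ^ j) ^ h * (3 * 2 ^ (j + 1)) ^ h : ℕ) : ENNReal)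
      * ENNReal.ofReal (2 * Real.exp (v - u j)) := by
    intro j
    refine (measure_biUnion_finset_le _ _).trans ?_
    refine (Finset.sum_le_card_nsmul _ _ (ENNReal.ofReal (2 * Real.exp (v - u j))) ?_).trans ?_
    · intro z hz
      obtain ⟨hz1, hz2⟩ := Finset.mem_filter.1 hz
      obtain ⟨hz3, hz4⟩ := Finset.mem_product.1 hz1
      exact htail _ (hNT _ hz4) _ (hNT _ hz3) _ (hρpos j) hz2 _
    · rw [nsmul_eq_mul]
      gcongr
      refine (Finset.card_filter_le _ _).trans ?_
      rw [Finset.card_product]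
      exact Nat.mul_le_mul (hNcard j) (hNcard (j + 1))
  have hbadall : μ (⋃ j, bad j) ≤ ε :=
    (measure_iUnion_le _).trans ((ENNReal.tsum_le_tsum hbad).trans hu)
  refine le_trans (measure_mono_ae ?_) hbadall
  filter_upwards [hcont] with ω hω
  rintro ⟨θ, hθ, hlt⟩
  by_contra hnot
  obtain ⟨R, hR⟩ := hω
  choose s hsN hs using fun j => hNnet j θ hθ
  have hs0 : s 0 = a := by simpa [hN0 0 rfl] using hsN 0
  have hlink : ∀ j, |Y (s (j + 1)) ω - Y (s j) ω| ≤ u j * (κ * ρ j) := by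
    intro j
    by_contra hj
    push Not at hj
    refine hnot (Set.mem_iUnion.2 ⟨j, Set.mem_iUnion₂.2 ⟨(s j, s (j + 1)), ?_, hj.le⟩⟩)
    refine Finset.mem_filter.2 ⟨Finset.mem_product.2 ⟨hsN j, hsN (j + 1)⟩, ?_⟩
    have h1 := hs j
    have h2 := hs (j + 1)
    have h3 : ‖s (j + 1) - s j‖ ≤ ‖s (j + 1) - θ‖ + ‖s j - θ‖ := by
      rw [norm_sub_rev (s j) θ]
      exact norm_sub_le_norm_sub_add_norm_sub _ _ _
    have h4 : r / 2 ^ (j + 1) ≤ r / 2 ^ j := by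
      gcongr
      · norm_num
      · omega
    have h5 : ((h : ℝ) + 1) * (r / 2 ^ (j + 1)) ≤ (h + 1) * (r / 2 ^ j) := by gcongr
    calc ‖s (j + 1) - s j‖ ≤ 2 * ((h + 1) * (r / 2 ^ j)) := by linarith
      _ = ρ j * r := by simp only [hρ]; ring
  have hpartial : ∀ J, |Y (s J) ω - Y a ω| ≤ ∑ j ∈ Finset.range J, u j * (κ * ρ j) := by
    intro J
    induction J with
    | zero => simp [hs0]
    | succ J ih =>
      rw [Finset.sum_range_succ]
      have := abs_sub_le (Y (s (J + 1)) ω) (Y (s J) ω) (Y a ω)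
      linarith [hlink J]
  have hbound : ∀ J, |Y (s J) ω - Y a ω| ≤ κ * ∑' j, u j * ρ j := by
    intro J
    refine (hpartial J).trans ?_
    have : ∑ j ∈ Finset.range J, u j * (κ * ρ j) = κ * ∑ j ∈ Finset.range J, u j * ρ j := by
      rw [Finset.mul_sum]
      exact Finset.sum_congr rfl fun j _ => by ring
    rw [this]
    gcongr
    exact hsum.sum_le_tsum _ fun j _ => mul_nonneg (hu0 j) (hρpos j).le
  have hsθ : Tendsto (fun J => R * ‖s J - θ‖) atTop (𝓝 0) := by
    have h1 : Tendsto (fun J : ℕ => ((h : ℝ) + 1) * (r / 2 ^ J)) atTop (𝓝 0) := by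
      have := (tendsto_pow_atTop_nhds_zero_of_lt_one (r := (1 / 2 : ℝ)) (by norm_num)
        (by norm_num)).const_mul ((h + 1) * r)
      rw [mul_zero] at this
      refine this.congr fun J => ?_
      rw [one_div, inv_pow]
      ring
    simpa using (squeeze_zero (fun _ => norm_nonneg _) hs h1).const_mul R
  have hYlim : Tendsto (fun J => Y (s J) ω) atTop (𝓝 (Y θ ω)) := by
    rw [tendsto_iff_dist_tendsto_zero]
    exact squeeze_zero (fun _ => dist_nonneg) (fun J => hR _ (hNT J (hsN J)) _ hθ) hsθ
  have := le_of_tendsto' ((hYlim.sub_const (Y a ω)).abs) hbound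
  exact absurd hlt (not_lt.2 this)

/-! ### Exponential tail bound for sums of bounded independent variables -/

lemma integral_exp_le {E : Type*} [MeasurableSpace E] {P : Measure E} [IsProbabilityMeasure P]
    {g : E → ℝ} (hg : Measurable g) (hb : ∀ᵐ x ∂P, |g x| ≤ 1) :
    Integrable (fun x => Real.exp (g x)) P ∧
      ∫ x, Real.exp (g x) ∂P ≤ Real.exp ((∫ x, g x ∂P) + ∫ x, g x ^ 2 ∂P) := by
  have hgi : Integrable g P := Integrable.of_bound hg.aestronglyMeasurable 1 hb
  have hg2 : Integrable (fun x => g x ^ 2) P := by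
    refine Integrable.of_bound (hg.pow_const 2).aestronglyMeasurable 1 ?_
    filter_upwards [hb] with x hx
    rw [Real.norm_eq_abs, abs_pow]
    exact pow_le_one₀ (abs_nonneg _) hx
  have hei : Integrable (fun x => Real.exp (g x)) P := by
    refine Integrable.of_bound hg.exp.aestronglyMeasurable (Real.exp 1) ?_
    filter_upwards [hb] with x hx
    rw [Real.norm_eq_abs, Real.abs_exp]
    exact Real.exp_le_exp.2 (le_of_abs_le hx)
  refine ⟨hei, ?_⟩
  have hlin : Integrable (fun x => 1 + g x) P := (integrable_const 1).add hgi
  have h1 : ∫ x, Real.exp (g x) ∂P ≤ ∫ x, (1 + g x + g x ^ 2) ∂P := by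
    refine integral_mono_ae hei (hlin.add hg2) ?_
    filter_upwards [hb] with x hx
    have := le_of_abs_le (Real.abs_exp_sub_one_sub_id_le hx)
    linarith
  have h2 : ∫ x, (1 + g x + g x ^ 2) ∂P = 1 + (∫ x, g x ∂P) + ∫ x, g x ^ 2 ∂P := by
    rw [integral_add hlin hg2, integral_add (integrable_const 1) hgi]
    simp
  rw [h2] at h1
  refine h1.trans ?_
  have := Real.add_one_le_exp ((∫ x, g x ∂P) + ∫ x, g x ^ 2 ∂P)
  linarith

section Empirical

variable {Ω E : Type*} [MeasurableSpace Ω] [MeasurableSpace E] {μ : Measure Ω}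
  [IsProbabilityMeasure μ] {P : Measure E} [IsProbabilityMeasure P] {X : ℕ → Ω → E}

lemma measure_sum_ge_le (hindep : iIndepFun X μ) (hlaw : ∀ i, HasLaw (X i) P μ)
    {g : E → ℝ} (hg : Measurable g) (hb : ∀ᵐ x ∂P, |g x| ≤ 1) (n : ℕ) {v : ℝ}
    (hv : n * ∫ x, g x ^ 2 ∂P ≤ v) (u : ℝ) :
    μ {ω | u ≤ ∑ i ∈ Finset.range n, g (X i ω) - n * ∫ x, g x ∂P}
      ≤ ENNReal.ofReal (Real.exp (v - u)) := by
  obtain ⟨hei, hle⟩ := integral_exp_le hg hb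
  set m := ∫ x, g x ∂P
  have hind : iIndepFun (fun i => g ∘ X i) μ := hindep.comp (fun _ => g) fun _ => hg
  have hmeas : ∀ i, AEMeasurable (g ∘ X i) μ := fun i => hg.comp_aemeasurable (hlaw i).aemeasurable
  have hmgf1 : ∀ i, mgf (g ∘ X i) μ 1 = ∫ x, Real.exp (g x) ∂P := by
    intro i
    rw [← (hlaw i).integral_comp hei.1]
    simp [mgf]
  have hmgf : mgf (∑ i ∈ Finset.range n, g ∘ X i) μ 1 ≤ Real.exp (n * m + v) := by
    rw [hind.mgf_sum₀ hmeas]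
    simp only [hmgf1, Finset.prod_const, Finset.card_range]
    calc (∫ x, Real.exp (g x) ∂P) ^ n ≤ (Real.exp (m + ∫ x, g x ^ 2 ∂P)) ^ n :=
          pow_le_pow_left₀ (integral_nonneg fun x => (Real.exp_pos _).le) hle n
      _ = Real.exp (n * m + n * ∫ x, g x ^ 2 ∂P) := by rw [← Real.exp_nat_mul]; ring_nf
      _ ≤ _ := Real.exp_le_exp.2 (by linarith)
  have hbω : ∀ᵐ ω ∂μ, ∀ i, |g (X i ω)| ≤ 1 := by
    rw [ae_all_iff]
    intro i
    refine ae_of_ae_map (p := fun x => |g x| ≤ 1) (hlaw i).aemeasurable ?_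
    rwa [(hlaw i).map_eq]
  have hint : Integrable (fun ω => Real.exp (1 * (∑ i ∈ Finset.range n, g ∘ X i) ω)) μ := by
    refine Integrable.of_bound (C := Real.exp n) ?_ ?_
    · refine (AEMeasurable.exp (AEMeasurable.const_mul ?_ 1)).aestronglyMeasurable
      exact Finset.aemeasurable_sum _ fun i _ => hmeas i
    · filter_upwards [hbω] with ω hω
      rw [Real.norm_eq_abs, Real.abs_exp, one_mul, Real.exp_le_exp, Finset.sum_apply]
      calc ∑ i ∈ Finset.range n, (g ∘ X i) ω ≤ ∑ i ∈ Finset.range n, 1 :=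
            Finset.sum_le_sum fun i _ => le_of_abs_le (hω i)
        _ = n := by simp
  have hch := measure_ge_le_exp_mul_mgf (μ := μ) (X := ∑ i ∈ Finset.range n, g ∘ X i) (t := 1)
    (u + n * m) zero_le_one hint
  have hset : {ω | u ≤ ∑ i ∈ Finset.range n, g (X i ω) - n * m}
      = {ω | u + n * m ≤ (∑ i ∈ Finset.range n, g ∘ X i) ω} := by
    ext ω
    simp only [Set.mem_ofPred_eq, Finset.sum_apply, Function.comp_apply]
    exact le_sub_iff_add_le
  rw [hset, ← ofReal_measureReal]
  refine ENNReal.ofReal_le_ofReal (hch.trans ?_)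
  calc Real.exp (-1 * (u + n * m)) * mgf (∑ i ∈ Finset.range n, g ∘ X i) μ 1
      ≤ Real.exp (-1 * (u + n * m)) * Real.exp (n * m + v) := by gcongr
    _ = Real.exp (v - u) := by rw [← Real.exp_add]; ring_nf

lemma measure_abs_sum_ge_le (hindep : iIndepFun X μ) (hlaw : ∀ i, HasLaw (X i) P μ)
    {g : E → ℝ} (hg : Measurable g) {b : ℝ} (hb0 : 0 < b) (hb : ∀ᵐ x ∂P, |g x| ≤ b) (n : ℕ)
    {v : ℝ} (hv : n * ∫ x, g x ^ 2 ∂P ≤ v * b ^ 2) (u : ℝ) :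
    μ {ω | u * b ≤ |∑ i ∈ Finset.range n, g (X i ω) - n * ∫ x, g x ∂P|}
      ≤ ENNReal.ofReal (2 * Real.exp (v - u)) := by
  have key : ∀ σ : ℝ, |σ| = 1 →
      μ {ω | u ≤ ∑ i ∈ Finset.range n, σ / b * g (X i ω) - n * ∫ x, σ / b * g x ∂P}
        ≤ ENNReal.ofReal (Real.exp (v - u)) := by
    intro σ hσ
    have hσ2 : σ ^ 2 = 1 := by rw [← sq_abs, hσ, one_pow]
    refine measure_sum_ge_le (g := fun x => σ / b * g x) hindep hlaw (hg.const_mul _) ?_ n ?_ u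
    · filter_upwards [hb] with x hx
      rw [abs_mul, abs_div, hσ, abs_of_pos hb0, one_div, inv_mul_le_iff₀ hb0, mul_one]
      exact hx
    · simp only [mul_pow, div_pow, hσ2]
      rw [integral_const_mul]
      calc n * (1 / b ^ 2 * ∫ x, g x ^ 2 ∂P) = (n * ∫ x, g x ^ 2 ∂P) / b ^ 2 := by ring
        _ ≤ v := by rwa [div_le_iff₀ (by positivity)]
  have hsub : {ω | u * b ≤ |∑ i ∈ Finset.range n, g (X i ω) - n * ∫ x, g x ∂P|}
      ⊆ {ω | u ≤ ∑ i ∈ Finset.range n, 1 / b * g (X i ω) - n * ∫ x, 1 / b * g x ∂P}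
        ∪ {ω | u ≤ ∑ i ∈ Finset.range n, -1 / b * g (X i ω) - n * ∫ x, -1 / b * g x ∂P} := by
    intro ω hω
    simp only [Set.mem_ofPred_eq, Set.mem_union, integral_const_mul, ← Finset.mul_sum] at hω ⊢
    rcases le_abs.1 hω with h | h
    · left
      rw [← le_div_iff₀ hb0] at h
      calc u ≤ _ := h
        _ = _ := by ring
    · right
      rw [← le_div_iff₀ hb0] at h
      calc u ≤ _ := h
        _ = _ := by ring
  refine (measure_mono hsub).trans ((measure_union_le _ _).trans ?_)
  refine (add_le_add (key 1 (by simp)) (key (-1) (by simp))).trans ?_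
  rw [← ENNReal.ofReal_add (Real.exp_pos _).le (Real.exp_pos _).le, two_mul]

end Empirical

/-! ### Empirical processes indexed by Lipschitz classes -/

lemma ae_forall_of_hasLaw {Ω E : Type*} [MeasurableSpace Ω] [MeasurableSpace E] {μ : Measure Ω}
    {P : Measure E} {X : ℕ → Ω → E} (hlaw : ∀ i, HasLaw (X i) P μ) {q : E → Prop}
    (h : ∀ᵐ x ∂P, q x) :
    ∀ᵐ ω ∂μ, ∀ i, q (X i ω) := by
  rw [ae_all_iff]
  intro i
  refine ae_of_ae_map (p := q) (hlaw i).aemeasurable ?_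
  rwa [(hlaw i).map_eq]

lemma measure_exists_gt_le {Ω E : Type*} [MeasurableSpace Ω] [MeasurableSpace E] {μ : Measure Ω}
    {P : Measure E} [IsProbabilityMeasure P] {X : ℕ → Ω → E} (hlaw : ∀ i, HasLaw (X i) P μ)
    {L : E → ℝ} (hL : Measurable L)
    (hL2 : MemLp L 2 P) {c : ℝ} (hc : 0 < c) {n : ℕ} (hn : 0 < n) :
    μ {ω | ∃ i < n, c * √n < |L (X i ω)|} ≤ ENNReal.ofReal ((∫ x, L x ^ 2 ∂P) / c ^ 2) := by
  have hn' : (0 : ℝ) < n := by exact_mod_cast hn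
  have hmeas : MeasurableSet {x | c * √n < |L x|} :=
    measurableSet_lt measurable_const hL.abs
  have h1 : P {x | c * √n < |L x|} ≤ ENNReal.ofReal ((∫ x, L x ^ 2 ∂P) / (c ^ 2 * n)) := by
    have hm := mul_meas_ge_le_integral_of_nonneg (μ := P) (f := fun x => L x ^ 2)
      (Eventually.of_forall fun x => sq_nonneg (L x)) hL2.integrable_sq (c ^ 2 * n)
    have hsub : {x | c * √n < |L x|} ⊆ {x | c ^ 2 * n ≤ L x ^ 2} := by
      intro x hx
      have hx' : c * √n < |L x| := hx
      have := pow_le_pow_left₀ (by positivity) hx'.le 2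
      rwa [sq_abs, mul_pow, Real.sq_sqrt hn'.le] at this
    rw [← ofReal_measureReal]
    refine ENNReal.ofReal_le_ofReal ?_
    rw [le_div_iff₀ (by positivity), mul_comm]
    exact (mul_le_mul_of_nonneg_left (measureReal_mono hsub) (by positivity)).trans hm
  have hsub : {ω | ∃ i < n, c * √n < |L (X i ω)|}
      ⊆ ⋃ i ∈ Finset.range n, {ω | c * √n < |L (X i ω)|} := by
    rintro ω ⟨i, hi, h⟩
    exact Set.mem_iUnion₂.2 ⟨i, Finset.mem_range.2 hi, h⟩
  refine (measure_mono hsub).trans ((measure_biUnion_finset_le _ _).trans ?_)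
  have h2 : ∀ i ∈ Finset.range n, μ {ω | c * √n < |L (X i ω)|}
      ≤ ENNReal.ofReal ((∫ x, L x ^ 2 ∂P) / (c ^ 2 * n)) := by
    intro i _
    rw [(hlaw i).measure_eq hmeas]
    exact h1
  refine (Finset.sum_le_card_nsmul _ _ _ h2).trans ?_
  rw [Finset.card_range, nsmul_eq_mul, ← ENNReal.ofReal_natCast, ← ENNReal.ofReal_mul hn'.le]
  refine ENNReal.ofReal_le_ofReal (le_of_eq ?_)
  field_simp

section LipschitzEmpirical

variable {Ω E : Type*} [MeasurableSpace Ω] [MeasurableSpace E] {μ : Measure Ω}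
  [IsProbabilityMeasure μ] {P : Measure E} [IsProbabilityMeasure P] {X : ℕ → Ω → E}

/-- The class of functions `w θ`, `θ ∈ Θ`, is Lipschitz in the parameter, `P`-almost everywhere with
constant `L x`. -/
structure LipschitzClass {h : ℕ} (P : Measure E) (Θ : Set (Vec h)) (w : Vec h → E → ℝ)
    (L : E → ℝ) : Prop where
  measurable : ∀ θ ∈ Θ, Measurable (w θ)
  measurable_lip : Measurable L
  memLp : MemLp L 2 P
  lipschitz : ∀ᵐ x ∂P, ∀ θ₁ ∈ Θ, ∀ θ₂ ∈ Θ, |w θ₁ x - w θ₂ x| ≤ L x * ‖θ₁ - θ₂‖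

/-- Local maximal inequality: in a ball of radius `B / √n`, the unnormalized empirical process
indexed by a Lipschitz class is bounded in probability. -/
lemma LipschitzClass.exists_bound {h : ℕ} {Θ : Set (Vec h)} {w : Vec h → E → ℝ} {L : E → ℝ}
    (hw : LipschitzClass P Θ w L) (hindep : iIndepFun X μ) (hlaw : ∀ i, HasLaw (X i) P μ)
    {a : Vec h} (ha : a ∈ Θ) {B : ℝ} (hB : 0 < B) {ε : ENNReal} (hε : 0 < ε) :
    ∃ A : ℝ, ∀ n : ℕ, 0 < n →
      μ {ω | ∃ θ ∈ Θ, √n * ‖θ - a‖ ≤ B ∧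
        A < ∑ i ∈ Finset.range n, (w θ (X i ω) - w a (X i ω)) - n * ∫ x, (w θ x - w a x) ∂P}
        ≤ ε := by
  have hε2 : 0 < ε / 2 := ENNReal.half_pos hε.ne'
  set V : ℝ := ∫ x, L x ^ 2 ∂P with hV
  have hV0 : 0 ≤ V := integral_nonneg fun x => sq_nonneg _
  have hL2 : Integrable (fun x => L x ^ 2) P := hw.memLp.integrable_sq
  have hL1 : Integrable (fun x => |L x|) P := (hw.memLp.integrable one_le_two).abs
  obtain ⟨c, hc, hc1⟩ : ∃ c : ℝ, ENNReal.ofReal (V / c ^ 2) < ε / 2 ∧ 1 ≤ c := by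
    have hlim : Tendsto (fun c : ℝ => ENNReal.ofReal (V / c ^ 2)) atTop (𝓝 0) := by
      have := (tendsto_pow_atTop (α := ℝ) two_ne_zero).const_div_atTop V
      simpa using ENNReal.tendsto_ofReal this
    exact ((hlim.eventually (gt_mem_nhds hε2)).and (eventually_ge_atTop 1)).exists
  have hc0 : 0 < c := by linarith
  obtain ⟨A, hA⟩ := exists_chaining_bound μ h (V / c ^ 2) hε2
  refine ⟨c * B * A + B * V / c, fun n hn => ?_⟩
  have hn' : (0 : ℝ) < n := by exact_mod_cast hn
  have hsn : 0 < √(n : ℝ) := Real.sqrt_pos.2 hn'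
  set S : Set E := {x | |L x| ≤ c * √n} with hS
  have hSm : MeasurableSet S := measurableSet_le hw.measurable_lip.abs measurable_const
  let g : Vec h → E → ℝ := fun θ => S.indicator fun x => w θ x - w a x
  have hgm : ∀ θ ∈ Θ, Measurable (g θ) := fun θ hθ =>
    ((hw.measurable θ hθ).sub (hw.measurable a ha)).indicator hSm
  have hgsub : ∀ s t x, g s x - g t x = S.indicator (fun x => w s x - w t x) x := by
    intro s t x
    by_cases hx : x ∈ S <;> simp [g, hx]
  have hlip : ∀ᵐ x ∂P, ∀ s ∈ Θ, ∀ t ∈ Θ, |w s x - w t x| ≤ |L x| * ‖s - t‖ := by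
    filter_upwards [hw.lipschitz] with x hx s hs t ht
    exact (hx s hs t ht).trans (by gcongr; exact le_abs_self _)
  have hglip : ∀ᵐ x ∂P, ∀ s ∈ Θ, ∀ t ∈ Θ, |g s x - g t x| ≤ |L x| * ‖s - t‖ := by
    filter_upwards [hlip] with x hx s hs t ht
    rw [hgsub]
    by_cases hxS : x ∈ S
    · simpa [hxS] using hx s hs t ht
    · simpa [hxS] using mul_nonneg (abs_nonneg (L x)) (norm_nonneg (s - t))
  have hgb : ∀ᵐ x ∂P, ∀ s ∈ Θ, ∀ t ∈ Θ, |g s x - g t x| ≤ c * √n * ‖s - t‖ := by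
    filter_upwards [hlip] with x hx s hs t ht
    rw [hgsub]
    by_cases hxS : x ∈ S
    · simp only [hxS, Set.indicator_of_mem]
      exact (hx s hs t ht).trans (mul_le_mul_of_nonneg_right hxS (norm_nonneg _))
    · simpa [hxS] using mul_nonneg (mul_nonneg hc0.le hsn.le) (norm_nonneg (s - t))
  have hga : ∀ x, g a x = 0 := fun x => by simp [g]
  have hgi : ∀ θ ∈ Θ, Integrable (g θ) P := by
    intro θ hθ
    refine Integrable.mono' (hL1.mul_const ‖θ - a‖) (hgm θ hθ).aestronglyMeasurable ?_
    filter_upwards [hglip] with x hx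
    simpa [hga] using hx θ hθ a ha
  have hwi : ∀ θ ∈ Θ, Integrable (fun x => w θ x - w a x) P := by
    intro θ hθ
    refine Integrable.mono' (hL1.mul_const ‖θ - a‖)
      ((hw.measurable θ hθ).sub (hw.measurable a ha)).aestronglyMeasurable ?_
    filter_upwards [hlip] with x hx
    exact hx θ hθ a ha
  let Y : Vec h → Ω → ℝ := fun θ ω =>
    ∑ i ∈ Finset.range n, g θ (X i ω) - n * ∫ x, g θ x ∂P
  have hYsub : ∀ s ∈ Θ, ∀ t ∈ Θ, ∀ ω, Y s ω - Y t ω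
      = ∑ i ∈ Finset.range n, (g s (X i ω) - g t (X i ω)) - n * ∫ x, (g s x - g t x) ∂P := by
    intro s hs t ht ω
    rw [Finset.sum_sub_distrib, integral_sub (hgi s hs) (hgi t ht)]
    simp only [Y]
    ring
  have hYa : ∀ ω, Y a ω = 0 := fun ω => by simp [Y, hga]
  let T : Set (Vec h) := {θ | θ ∈ Θ ∧ √n * ‖θ - a‖ ≤ B}
  have hchain : μ {ω | ∃ θ ∈ T, c * B * A < |Y θ ω - Y a ω|} ≤ ε / 2 := by
    refine hA T a (B / √n) (c * B) Y (by positivity) (by positivity) ⟨ha, by simpa using hB.le⟩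
      ?_ ?_ ?_
    · intro θ hθ
      rw [le_div_iff₀ hsn, mul_comm]
      exact hθ.2
    · intro s hs t ht ρ hρ hst u
      simp only [hYsub s hs.1 t ht.1]
      have hst' : √n * ‖s - t‖ ≤ ρ * B := by
        calc √n * ‖s - t‖ ≤ √n * (ρ * (B / √n)) := by gcongr
          _ = ρ * B := by field_simp
      refine measure_abs_sum_ge_le (g := fun x => g s x - g t x) hindep hlaw
        ((hgm s hs.1).sub (hgm t ht.1)) (by positivity) ?_ n ?_ u
      · filter_upwards [hgb] with x hx
        refine (hx s hs.1 t ht.1).trans ?_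
        calc c * √n * ‖s - t‖ = c * (√n * ‖s - t‖) := by ring
          _ ≤ c * (ρ * B) := by gcongr
          _ = c * B * ρ := by ring
      · have h1 : ∫ x, (g s x - g t x) ^ 2 ∂P ≤ V * ‖s - t‖ ^ 2 := by
          rw [hV, ← integral_mul_const]
          refine integral_mono_of_nonneg (Eventually.of_forall fun x => sq_nonneg _)
            (hL2.mul_const _) ?_
          filter_upwards [hglip] with x hx
          have := pow_le_pow_left₀ (abs_nonneg _) (hx s hs.1 t ht.1) 2
          rwa [sq_abs, mul_pow, sq_abs] at this
        have h2 : n * ‖s - t‖ ^ 2 ≤ (ρ * B) ^ 2 := by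
          have := pow_le_pow_left₀ (by positivity) hst' 2
          rwa [mul_pow, Real.sq_sqrt hn'.le] at this
        calc n * ∫ x, (g s x - g t x) ^ 2 ∂P ≤ n * (V * ‖s - t‖ ^ 2) := by gcongr
          _ = V * (n * ‖s - t‖ ^ 2) := by ring
          _ ≤ V * (ρ * B) ^ 2 := by gcongr
          _ = V / c ^ 2 * (c * B * ρ) ^ 2 := by field_simp
    · filter_upwards [ae_forall_of_hasLaw hlaw hglip] with ω hω
      refine ⟨∑ i ∈ Finset.range n, |L (X i ω)| + n * ∫ x, |L x| ∂P, fun s hs t ht => ?_⟩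
      rw [hYsub s hs.1 t ht.1, add_mul]
      refine (abs_sub _ _).trans (add_le_add ?_ ?_)
      · rw [Finset.sum_mul]
        exact (Finset.abs_sum_le_sum_abs _ _).trans
          (Finset.sum_le_sum fun i _ => hω i s hs.1 t ht.1)
      · rw [abs_mul, abs_of_pos hn', mul_assoc, ← integral_mul_const]
        gcongr
        refine abs_integral_le_integral_abs.trans ?_
        refine integral_mono_of_nonneg (Eventually.of_forall fun x => abs_nonneg _)
          (hL1.mul_const _) ?_
        filter_upwards [hglip] with x hx
        exact hx s hs.1 t ht.1
  have htrunc := (measure_exists_gt_le hlaw hw.measurable_lip hw.memLp hc0 hn).trans hc.le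
  refine le_trans (measure_mono ?_) ((measure_union_le _ _).trans
    ((add_le_add hchain htrunc).trans (ENNReal.add_halves ε).le))
  rintro ω ⟨θ, hθ, hθB, hlt⟩
  by_contra hnot
  rw [Set.mem_union, not_or] at hnot
  obtain ⟨h1, h2⟩ := hnot
  have h1' : |Y θ ω| ≤ c * B * A := by
    by_contra h
    push Not at h
    exact h1 ⟨θ, ⟨hθ, hθB⟩, by rwa [hYa, sub_zero]⟩
  have h2' : ∀ i < n, X i ω ∈ S := by
    intro i hi
    by_contra h
    exact h2 ⟨i, hi, not_le.1 h⟩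
  have hsum : ∑ i ∈ Finset.range n, (w θ (X i ω) - w a (X i ω))
      = ∑ i ∈ Finset.range n, g θ (X i ω) :=
    Finset.sum_congr rfl fun i hi => by simp [g, h2' i (Finset.mem_range.1 hi)]
  have hcenter : n * (∫ x, g θ x ∂P) - n * ∫ x, (w θ x - w a x) ∂P ≤ B * V / c := by
    rw [← mul_sub, ← integral_sub (hgi θ hθ) (hwi θ hθ)]
    have h3 : ∫ x, (g θ x - (w θ x - w a x)) ∂P ≤ V * (‖θ - a‖ / (c * √n)) := by
      rw [hV, ← integral_mul_const]
      refine integral_mono_ae ((hgi θ hθ).sub (hwi θ hθ)) (hL2.mul_const _) ?_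
      filter_upwards [hlip] with x hx
      by_cases hxS : x ∈ S
      · simp only [g, hxS, Set.indicator_of_mem, sub_self]
        positivity
      · simp only [g, hxS, not_false_eq_true, Set.indicator_of_notMem, zero_sub]
        have h4 : c * √n < |L x| := not_le.1 hxS
        calc -(w θ x - w a x) ≤ |L x| * ‖θ - a‖ := (neg_le_abs _).trans (hx θ hθ a ha)
          _ = |L x| * (c * √n) * (‖θ - a‖ / (c * √n)) := by field_simp
          _ ≤ |L x| * |L x| * (‖θ - a‖ / (c * √n)) := by gcongr
          _ = L x ^ 2 * (‖θ - a‖ / (c * √n)) := by rw [abs_mul_abs_self, sq]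
    calc n * ∫ x, (g θ x - (w θ x - w a x)) ∂P ≤ n * (V * (‖θ - a‖ / (c * √n))) := by gcongr
      _ = (√n * ‖θ - a‖) * (V / c) := by
          have : (n : ℝ) = √n * √n := (Real.mul_self_sqrt hn'.le).symm
          rw [this, Real.sqrt_mul_self hsn.le]
          field_simp
      _ ≤ B * (V / c) := by gcongr
      _ = B * V / c := by ring
  rw [hsum] at hlt
  have h5 := le_of_abs_le h1'
  simp only [Y] at h5
  linarith

end LipschitzEmpirical

/-! ### Laws of large numbers -/

section LLN

variable {Ω E : Type*} [MeasurableSpace Ω] [MeasurableSpace E] {μ : Measure Ω}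
  [IsProbabilityMeasure μ] {P : Measure E} {X : ℕ → Ω → E}

lemma tendsto_measure_average (hindep : iIndepFun X μ) (hlaw : ∀ i, HasLaw (X i) P μ)
    {f : E → ℝ} (hf : Measurable f) (hfi : Integrable f P) {η : ℝ} (hη : 0 < η) :
    Tendsto (fun n : ℕ => μ {ω | η ≤ |(1 / (n : ℝ)) * ∑ i ∈ Finset.range n, f (X i ω)
      - ∫ x, f x ∂P|}) atTop (𝓝 0) := by
  have hmeas : ∀ i, AEMeasurable (fun ω => f (X i ω)) μ :=
    fun i => hf.comp_aemeasurable (hlaw i).aemeasurable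
  have hint : Integrable (fun ω => f (X 0 ω)) μ := by
    have h := hfi
    rw [← (hlaw 0).map_eq] at h
    exact h.comp_aemeasurable (hlaw 0).aemeasurable
  have hind : iIndepFun (fun i => f ∘ X i) μ := hindep.comp (fun _ => f) fun _ => hf
  have hid : ∀ i, IdentDistrib (fun ω => f (X i ω)) (fun ω => f (X 0 ω)) μ μ := fun i =>
    IdentDistrib.comp ⟨(hlaw i).aemeasurable, (hlaw 0).aemeasurable,
      by rw [(hlaw i).map_eq, (hlaw 0).map_eq]⟩ hf
  have hslln := strong_law_ae_real (fun i ω => f (X i ω)) hint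
    (fun i j hij => hind.indepFun hij) hid
  have hmean : ∫ ω, f (X 0 ω) ∂μ = ∫ x, f x ∂P := (hlaw 0).integral_comp hfi.1
  have htm : TendstoInMeasure μ
      (fun (n : ℕ) ω => (1 / (n : ℝ)) * ∑ i ∈ Finset.range n, f (X i ω)) atTop
      (fun _ => ∫ x, f x ∂P) := by
    refine tendstoInMeasure_of_tendsto_ae (fun n => ?_) ?_
    · exact ((Finset.aemeasurable_fun_sum _ fun i _ => hmeas i).const_mul _).aestronglyMeasurable
    · filter_upwards [hslln] with ω hω
      rw [hmean] at hω
      refine hω.congr fun n => ?_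
      rw [div_eq_mul_inv, one_div, mul_comm]
  have := tendstoInMeasure_iff_norm.1 htm η hη
  simpa only [Real.norm_eq_abs] using this

/-- One-sided uniform law of large numbers for a Lipschitz class on a compact parameter space. -/
lemma LipschitzClass.exists_tendsto_measure [IsProbabilityMeasure P] {h : ℕ}
    {Θ : Set (Vec h)} {w : Vec h → E → ℝ}
    {L : E → ℝ} (hw : LipschitzClass P Θ w L) (hindep : iIndepFun X μ)
    (hlaw : ∀ i, HasLaw (X i) P μ) (hΘ : IsCompact Θ) (hwi : ∀ θ ∈ Θ, Integrable (w θ) P)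
    {m : ℝ} (hm : ∀ θ ∈ Θ, ∫ x, w θ x ∂P < m) :
    ∃ m' < m, Tendsto (fun n : ℕ => μ {ω | ∃ θ ∈ Θ,
      m' ≤ (1 / (n : ℝ)) * ∑ i ∈ Finset.range n, w θ (X i ω)}) atTop (𝓝 0) := by
  rcases Θ.eq_empty_or_nonempty with rfl | hne
  · exact ⟨m - 1, by linarith, by simp⟩
  have hL1 : Integrable (fun x => |L x|) P := (hw.memLp.integrable one_le_two).abs
  set Λ : ℝ := ∫ x, |L x| ∂P with hΛ
  have hΛ0 : 0 ≤ Λ := integral_nonneg fun x => abs_nonneg _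
  have hlip : ∀ᵐ x ∂P, ∀ s ∈ Θ, ∀ t ∈ Θ, |w s x - w t x| ≤ |L x| * ‖s - t‖ := by
    filter_upwards [hw.lipschitz] with x hx s hs t ht
    exact (hx s hs t ht).trans (by gcongr; exact le_abs_self _)
  have hcont : ContinuousOn (fun θ => ∫ x, w θ x ∂P) Θ := by
    refine LipschitzOnWith.continuousOn (K := Λ.toNNReal) (LipschitzOnWith.of_dist_le_mul ?_)
    intro s hs t ht
    rw [Real.dist_eq, dist_eq_norm, ← integral_sub (hwi s hs) (hwi t ht), Real.coe_toNNReal _ hΛ0,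
      hΛ, ← integral_mul_const]
    refine abs_integral_le_integral_abs.trans (integral_mono_of_nonneg
      (Eventually.of_forall fun x => abs_nonneg _) (hL1.mul_const _) ?_)
    filter_upwards [hlip] with x hx
    exact hx s hs t ht
  obtain ⟨θ₀, hθ₀, hmax⟩ := hΘ.exists_isMaxOn hne hcont
  set m₀ := ∫ x, w θ₀ x ∂P with hm₀
  set η : ℝ := (m - m₀) / 4 with hη
  have hη0 : 0 < η := by have := hm θ₀ hθ₀; rw [hη]; linarith
  set δ : ℝ := η / (Λ + 1) with hδ
  have hδ0 : 0 < δ := by positivity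
  obtain ⟨F, hFΘ, hF, hcover⟩ := hΘ.finite_cover_balls hδ0
  refine ⟨m₀ + 2 * η, by rw [hη]; linarith, ?_⟩
  have hbound : Tendsto (fun n : ℕ => (∑ t ∈ hF.toFinset,
      μ {ω | η ≤ |(1 / (n : ℝ)) * ∑ i ∈ Finset.range n, w t (X i ω) - ∫ x, w t x ∂P|})
      + μ {ω | 1 ≤ |(1 / (n : ℝ)) * ∑ i ∈ Finset.range n, |L (X i ω)| - Λ|}) atTop (𝓝 0) := by
    rw [show (0 : ENNReal) = (∑ _t ∈ hF.toFinset, 0) + 0 by simp]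
    refine Tendsto.add (tendsto_finsetSum _ fun t ht => ?_) ?_
    · have htΘ := hFΘ (hF.mem_toFinset.1 ht)
      exact tendsto_measure_average hindep hlaw (hw.measurable t htΘ) (hwi t htΘ) hη0
    · exact tendsto_measure_average hindep hlaw hw.measurable_lip.abs hL1 one_pos
  refine tendsto_of_tendsto_of_tendsto_of_le_of_le tendsto_const_nhds hbound
    (fun _ => zero_le) fun n => ?_
  refine le_trans (measure_mono_ae ?_) ((measure_union_le _ _).trans
    (add_le_add_left (measure_biUnion_finset_le hF.toFinset _) _))
  filter_upwards [ae_forall_of_hasLaw hlaw hlip] with ω hω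
  rintro ⟨θ, hθ, hle⟩
  by_contra hnot
  obtain ⟨h1, h2⟩ := not_or.1 hnot
  have h2' : (1 / (n : ℝ)) * ∑ i ∈ Finset.range n, |L (X i ω)| < Λ + 1 := by
    have h3 : ¬ 1 ≤ |(1 / (n : ℝ)) * ∑ i ∈ Finset.range n, |L (X i ω)| - Λ| := h2
    have := (abs_lt.1 (not_le.1 h3)).2
    linarith
  obtain ⟨t, ht, htθ⟩ := Set.mem_iUnion₂.1 (hcover hθ)
  have h1' : (1 / (n : ℝ)) * ∑ i ∈ Finset.range n, w t (X i ω) < m₀ + η := by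
    have h3 : ¬ η ≤ |(1 / (n : ℝ)) * ∑ i ∈ Finset.range n, w t (X i ω) - ∫ x, w t x ∂P| :=
      fun h => h1 (Set.mem_iUnion₂.2 ⟨t, hF.mem_toFinset.2 ht, h⟩)
    have h4 := (abs_lt.1 (not_le.1 h3)).2
    have h5 : ∫ x, w t x ∂P ≤ m₀ := hmax (hFΘ ht)
    linarith
  have hstep : (1 / (n : ℝ)) * ∑ i ∈ Finset.range n, w θ (X i ω)
      ≤ (1 / (n : ℝ)) * ∑ i ∈ Finset.range n, w t (X i ω)
        + ((1 / (n : ℝ)) * ∑ i ∈ Finset.range n, |L (X i ω)|) * δ := by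
    rw [mul_assoc, ← mul_add, Finset.sum_mul, ← Finset.sum_add_distrib]
    refine mul_le_mul_of_nonneg_left (Finset.sum_le_sum fun i _ => ?_) (by positivity)
    have h6 := le_of_abs_le (hω i θ hθ t (hFΘ ht))
    have h7 : |L (X i ω)| * ‖θ - t‖ ≤ |L (X i ω)| * δ := by
      gcongr
      rw [← dist_eq_norm]
      exact (Metric.mem_ball.1 htθ).le
    linarith
  have h8 : ((1 / (n : ℝ)) * ∑ i ∈ Finset.range n, |L (X i ω)|) * δ < η := by
    calc _ < (Λ + 1) * δ := by gcongr
      _ = η := by rw [hδ]; field_simp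
  linarith

end LLN

/-! ### Expectations of the objective function -/

lemma integrable_law_iff {d : ℕ} {p : Vec d → ℝ} (hp : ∀ x, 0 ≤ p x) (hpm : Measurable p)
    {f : Vec d → ℝ} : Integrable f (law p) ↔ Integrable fun x => p x * f x := by
  rw [law, integrable_withDensity_iff_integrable_smul' hpm.ennreal_ofReal
    (Eventually.of_forall fun _ => ENNReal.ofReal_lt_top)]
  simp only [ENNReal.toReal_ofReal (hp _), smul_eq_mul]

lemma integral_law {d : ℕ} {p : Vec d → ℝ} (hp : ∀ x, 0 ≤ p x) (hpm : Measurable p)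
    (f : Vec d → ℝ) : ∫ x, f x ∂(law p) = ∫ x, p x * f x := by
  rw [law, integral_withDensity_eq_integral_toReal_smul hpm.ennreal_ofReal
    (Eventually.of_forall fun _ => ENNReal.ofReal_lt_top)]
  simp only [ENNReal.toReal_ofReal (hp _), smul_eq_mul]

lemma IsRegularPDF.measurable {d : ℕ} {p : Vec d → ℝ} (hp : IsRegularPDF p) : Measurable p :=
  hp.differentiable.continuous.measurable

lemma IsRegularPDF.integrable {d : ℕ} {p : Vec d → ℝ} (hp : IsRegularPDF p) : Integrable p := by
  refine ⟨hp.measurable.aestronglyMeasurable, ?_⟩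
  rw [hasFiniteIntegral_iff_ofReal (Eventually.of_forall hp.nonneg), hp.lintegral_eq_one]
  exact ENNReal.one_lt_top

lemma IsRegularPDF.eq_of_eq_const_mul {d : ℕ} {p q : Vec d → ℝ} (hp : IsRegularPDF p)
    (hq : IsRegularPDF q) (hppos : ∀ x, 0 < p x) (hqpos : ∀ x, 0 < q x) {c : ℝ}
    (h : ∀ x, p x = c * q x) : p = q := by
  have hc : 0 < c := by
    have h0 := hppos 0
    rw [h 0] at h0
    exact (pos_iff_pos_of_mul_pos h0).2 (hqpos 0)
  have h1 := hp.lintegral_eq_one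
  simp only [h, ENNReal.ofReal_mul hc.le] at h1
  rw [lintegral_const_mul _ hq.measurable.ennreal_ofReal, hq.lintegral_eq_one, mul_one,
    ENNReal.ofReal_eq_one] at h1
  ext x
  rw [h, h1, one_mul]

lemma IsRegularPDF.integral_W_le {d : ℕ} {p q : Vec d → ℝ} (hp : IsRegularPDF p)
    (hq : IsRegularPDF q) (hppos : ∀ x, 0 < p x) (hqpos : ∀ x, 0 < q x)
    (hWp : Integrable (W p) (law p)) (hWq : Integrable (W q) (law p)) :
    ∫ x, W q x ∂(law p) ≤ ∫ x, W p x ∂(law p) := by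
  have h := (hp.isLogRegular hppos).integral_mul_W_sub_nonneg (hq.isLogRegular hqpos)
    hp.integrable ((integrable_law_iff hp.nonneg hp.measurable).1 (hWp.sub hWq))
  rw [← integral_law hp.nonneg hp.measurable fun x => W p x - W q x, integral_sub hWp hWq] at h
  linarith

lemma IsRegularPDF.integral_W_lt {d : ℕ} {p q : Vec d → ℝ} (hp : IsRegularPDF p)
    (hq : IsRegularPDF q) (hppos : ∀ x, 0 < p x) (hqpos : ∀ x, 0 < q x)
    (hWp : Integrable (W p) (law p)) (hWq : Integrable (W q) (law p)) (hne : q ≠ p) :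
    ∫ x, W q x ∂(law p) < ∫ x, W p x ∂(law p) := by
  by_contra hnot
  push Not at hnot
  obtain ⟨c, hc⟩ := (hp.isLogRegular hppos).exists_eq_const_mul (hq.isLogRegular hqpos)
    hp.integrable ((integrable_law_iff hp.nonneg hp.measurable).1 (hWp.sub hWq)) (by
      have := integral_law hp.nonneg hp.measurable fun x => W p x - W q x
      rw [integral_sub hWp hWq] at this
      linarith)
  exact hne (hp.eq_of_eq_const_mul hq hppos hqpos hc).symm

lemma IsRegularPDF.integral_W_pos {d : ℕ} {p : Vec d → ℝ} (hp : IsRegularPDF p)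
    (hppos : ∀ x, 0 < p x) (hWp : Integrable (W p) (law p)) (i : Fin d) :
    0 < ∫ x, W p x ∂(law p) := by
  by_contra hnot
  push Not at hnot
  have hint := (integrable_law_iff hp.nonneg hp.measurable).1 hWp
  rw [integral_law hp.nonneg hp.measurable] at hnot
  obtain ⟨c, hc⟩ := (hp.isLogRegular hppos).exists_eq_const_mul isLogRegular_one hp.integrable
    (by simpa [W_one] using hint) (by simpa [W_one] using hnot)
  simp only [mul_one] at hc
  have h1 := hp.tendsto_atTop 0 i
  simp only [hc] at h1
  have h2 := tendsto_nhds_unique h1 tendsto_const_nhds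
  have h3 := hppos 0
  rw [hc, ← h2] at h3
  exact lt_irrefl _ h3

lemma ParametricModel.LipschitzInParam.exists_lipschitzClass {d : ℕ} {M : ParametricModel d}
    {p : Vec d → ℝ} (h : M.LipschitzInParam p) :
    ∃ L, LipschitzClass (law p) M.Θ (fun θ => W (M.pdf θ)) L := by
  obtain ⟨L₁, L₂, h1, h2, hL⟩ := h
  have hmem : MemLp (fun x => d * (2 * L₁ x + L₂ x)) 2 (law p) :=
    ((h1.const_mul 2).add h2).const_mul d
  refine ⟨hmem.1.mk _, fun θ _ => measurable_W _, hmem.1.stronglyMeasurable_mk.measurable,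
    hmem.ae_eq hmem.1.ae_eq_mk, ?_⟩
  filter_upwards [hmem.1.ae_eq_mk] with x hx θ₁ hθ₁ θ₂ hθ₂
  rw [← hx]
  obtain ⟨ha, hb⟩ := hL x θ₁ hθ₁ θ₂ hθ₂
  exact (abs_W_sub_le _ _ x ha hb).trans (le_of_eq (by ring))

lemma LipschitzClass.integrable {E : Type*} [MeasurableSpace E] {P : Measure E}
    [IsFiniteMeasure P] {h : ℕ} {Θ : Set (Vec h)} {w : Vec h → E → ℝ} {L : E → ℝ}
    (hw : LipschitzClass P Θ w L) {a : Vec h} (ha : a ∈ Θ) (hwa : Integrable (w a) P)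
    {θ : Vec h} (hθ : θ ∈ Θ) : Integrable (w θ) P := by
  have h1 : Integrable (fun x => w θ x - w a x) P := by
    refine Integrable.mono' ((hw.memLp.integrable one_le_two).mul_const ‖θ - a‖)
      ((hw.measurable θ hθ).sub (hw.measurable a ha)).aestronglyMeasurable ?_
    filter_upwards [hw.lipschitz] with x hx
    exact hx θ hθ a ha
  exact (h1.add hwa).congr (Eventually.of_forall fun x => sub_add_cancel (w θ x) (w a x))

/-! ### Comparison of the criterion across models -/

lemma ParametricModel.IsMGICE.gic_le {Ω : Type*} {d : ℕ} {X : ℕ → Ω → Vec d}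
    {M : ParametricModel d} {θhat : ℕ → Ω → Vec M.h}
    (h : M.IsMGICE X θhat) {θ : Vec M.h} (hθ : θ ∈ M.Θ) (n : ℕ) (ω : Ω) :
    M.gic X n ω θ ≤ M.gic X n ω (θhat n ω) :=
  (h n ω).2 hθ

section Selection

variable {Ω : Type*} [MeasurableSpace Ω] {μ : Measure Ω} [IsProbabilityMeasure μ] {d : ℕ}
  {p : Vec d → ℝ} {X : ℕ → Ω → Vec d}

lemma isProbabilityMeasure_law (hlaw : ∀ i, HasLaw (X i) (law p) μ) :
    IsProbabilityMeasure (law p) :=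
  (hlaw 0).isProbabilityMeasure_iff.1 inferInstance

/-- At a correctly specified model, the maximized criterion exceeds the criterion at the truth by
`O_P(1/n)`. -/
lemma eventually_measure_gic_gt_le (hindep : iIndepFun X μ)
    (hlaw : ∀ i, HasLaw (X i) (law p) μ) (hW : Integrable (W p) (law p))
    {M : ParametricModel d} (hreg : ∀ q ∈ M.densities, IsRegularPDF q)
    {θhat : ℕ → Ω → Vec M.h} (hθhat : M.IsMGICE X θhat) {θstar : Vec M.h}
    (hid : M.Identifiable p θstar) (hpos : M.Positive) (hlip : M.LipschitzInParam p)
    (hroot : RootNConsistent μ θhat θstar) {ε : ENNReal} (hε : 0 < ε) :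
    ∃ A : ℝ, ∀ᶠ n : ℕ in atTop,
      μ {ω | A < n * (M.gic X n ω (θhat n ω) - M.gic X n ω θstar)} ≤ ε := by
  have := isProbabilityMeasure_law hlaw
  obtain ⟨hθ, rfl, -⟩ := hid
  obtain ⟨L, hL⟩ := hlip.exists_lipschitzClass
  have hε2 : 0 < ε / 2 := ENNReal.half_pos hε.ne'
  obtain ⟨B, hB⟩ := hroot _ hε2
  obtain ⟨A, hA⟩ := hL.exists_bound hindep hlaw hθ (B := max B 1)
    (lt_max_of_lt_right one_pos) hε2
  refine ⟨A, ?_⟩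
  filter_upwards [hB, eventually_gt_atTop 0] with n hBn hn
  refine le_trans (measure_mono ?_) ((measure_union_le _ _).trans
    ((add_le_add hBn (hA n hn)).trans (ENNReal.add_halves ε).le))
  intro ω hω
  by_cases hBω : B < √(n : ℝ) * ‖θhat n ω - θstar‖
  · exact Or.inl hBω
  refine Or.inr ⟨θhat n ω, (hθhat n ω).1, (not_lt.1 hBω).trans (le_max_left _ _), ?_⟩
  have hθ' := (hθhat n ω).1
  have hWi := hL.integrable hθ hW hθ'
  have hmean : ∫ x, (W (M.pdf (θhat n ω)) x - W (M.pdf θstar) x) ∂(law (M.pdf θstar)) ≤ 0 := by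
    rw [integral_sub hWi hW, sub_nonpos]
    exact (hreg _ ⟨_, hθ, rfl⟩).integral_W_le (hreg _ ⟨_, hθ', rfl⟩) (hpos _ hθ) (hpos _ hθ')
      hW hWi
  have hn' : (0 : ℝ) < n := by exact_mod_cast hn
  have hgic : (n : ℝ) * (M.gic X n ω (θhat n ω) - M.gic X n ω θstar)
      = ∑ i ∈ Finset.range n, (W (M.pdf (θhat n ω)) (X i ω) - W (M.pdf θstar) (X i ω)) := by
    rw [ParametricModel.gic, ParametricModel.gic, Finset.sum_sub_distrib]
    field_simp
  have hω' : A < n * (M.gic X n ω (θhat n ω) - M.gic X n ω θstar) := hω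
  rw [hgic] at hω'
  have := mul_nonpos_of_nonneg_of_nonpos hn'.le hmean
  linarith

/-- A larger penalty on the model with the better fit reverses the comparison. -/
lemma mul_lt_mul_of_log_div_lt {c₁ c₂ G G' A m n : ℝ} (hn : 0 < n) (hc₁ : 0 < c₁) (hc₂ : 0 < c₂)
    (hm : 0 < m) (hG : m < G) (hG' : n * (G' - G) ≤ A) (hlog0 : n * Real.log (c₁ / c₂) < 0)
    (hlog : n * Real.log (c₁ / c₂) < -(A / m)) : c₁ * G' < c₂ * G := by
  set y := Real.log (c₁ / c₂) with hy
  have hc : c₂ = c₁ * Real.exp (-y) := by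
    rw [Real.exp_neg, hy, Real.exp_log (by positivity)]
    field_simp
  rw [hc, mul_assoc]
  refine mul_lt_mul_of_pos_left ?_ hc₁
  have h1 := Real.add_one_le_exp (-y)
  have h2 : (-y + 1) * G ≤ Real.exp (-y) * G := by
    gcongr
    linarith
  refine lt_of_lt_of_le ?_ h2
  have h3 : A < -(n * y) * m := by
    rw [← div_lt_iff₀ hm]
    linarith
  have h4 : -(n * y) * m ≤ -(n * y) * G := by gcongr; linarith
  have h5 : n * (G' - G) < n * (-y * G) := by linarith
  have := lt_of_mul_lt_mul_left h5 hn.le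
  linarith

end Selection

end MIC

open MeasureTheory ProbabilityTheory Filter Topology MIC in
theorem mainTheorem1 {Ω : Type*} [MeasurableSpace Ω] (μ : Measure Ω) [IsProbabilityMeasure μ]
    {d K : ℕ}
    -- the data: independent observations with density `p`, for which `E_p[W(x, p)]` is finite
    (p : Vec d → ℝ) (X : ℕ → Ω → Vec d)
    (hX_indep : iIndepFun X μ) (hX_law : ∀ i, HasLaw (X i) (law p) μ)
    (hW : Integrable (W p) (law p))
    -- the strictly nested candidate models, and the smallest one that contains the truth
    (M : Fin K → ParametricModel d)
    (hreg : ∀ k, ∀ q ∈ (M k).densities, IsRegularPDF q)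
    (hnested : StrictMono fun k => (M k).densities)
    (k₀ : Fin K) (hk₀ : IsLeast {k | p ∈ (M k).densities} k₀)
    -- the estimators
    (θhat : ∀ k, ℕ → Ω → Vec (M k).h) (hθhat : ∀ k, (M k).IsMGICE X (θhat k))
    -- the models that contain the truth
    (θstar : ∀ k, Vec (M k).h)
    (hover : ∀ k, k₀ ≤ k →
      (M k).Identifiable p (θstar k) ∧ (M k).Positive ∧ IsCompact (M k).Θ ∧
      (M k).LipschitzInParam p ∧ (M k).SmoothNear (θstar k) ∧
      RootNConsistent μ (θhat k) (θstar k) ∧ AsymptoticallyNormal μ (θhat k) (θstar k))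
    -- the models that do not
    (hunder : ∀ k, k < k₀ → IsCompact (M k).Θ ∧ (M k).LipschitzInParam p)
    -- the multiplying factor
    (C : ℕ → Fin K → ℝ)
    (hC_one : ∀ k, Tendsto (fun n => C n k) atTop (𝓝 1))
    (hC_log : ∀ k₁ k₂, k₂ < k₁ →
      Tendsto (fun n : ℕ => (n : ℝ) * Real.log (C n k₁ / C n k₂)) atTop atBot)
    -- the selected index
    (khat : ℕ → Ω → Fin K)
    (hkhat : ∀ n ω k, mic M X θhat C n ω k ≤ mic M X θhat C n ω (khat n ω)) :
    TendstoInMeasure μ (fun n ω => ((khat n ω : ℕ) : ℝ)) atTop (fun _ => ((k₀ : ℕ) : ℝ)) := by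
  have := isProbabilityMeasure_law hX_law
  have hmono : ∀ {k l}, k ≤ l → (M k).densities ⊆ (M l).densities :=
    fun h => hnested.monotone h
  obtain ⟨hid₀, hpos₀, -, hlip₀, -⟩ := hover k₀ le_rfl
  obtain ⟨hθ₀, hpdf₀, -⟩ := hid₀
  have hp : IsRegularPDF p := hreg k₀ p hk₀.1
  have hppos : ∀ x, 0 < p x := hpdf₀ ▸ hpos₀ _ hθ₀
  set m : ℝ := ∫ x, W p x ∂(law p) with hm
  have hdens : ∀ k, k₀ ≤ k → ∀ q ∈ (M k).densities,
      (∀ x, 0 < q x) ∧ Integrable (W q) (law p) := by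
    rintro k hk _ ⟨θ, hθ, rfl⟩
    obtain ⟨hid, hpos, -, hlip, -⟩ := hover k hk
    obtain ⟨L, hL⟩ := hlip.exists_lipschitzClass
    exact ⟨hpos θ hθ, hL.integrable hid.1 (by rwa [hid.2.1]) hθ⟩
  have hGIC : ∀ n ω, (M k₀).gic X n ω (θstar k₀)
      = (1 / (n : ℝ)) * ∑ i ∈ Finset.range n, W p (X i ω) := by
    intro n ω
    rw [ParametricModel.gic, hpdf₀]
  have hCpos : ∀ k, ∀ᶠ n in atTop, 0 < C n k := fun k =>
    (hC_one k).eventually (lt_mem_nhds one_pos)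
  have hunderfit : ∀ k, k < k₀ → Tendsto (fun n => μ {ω | khat n ω = k}) atTop (𝓝 0) := by
    intro k hk
    obtain ⟨hcompact, hlip⟩ := hunder k hk
    obtain ⟨L, hL⟩ := hlip.exists_lipschitzClass
    have hq : ∀ θ ∈ (M k).Θ, (M k).pdf θ ∈ (M k).densities := fun θ hθ => ⟨θ, hθ, rfl⟩
    have hint : ∀ θ ∈ (M k).Θ, Integrable (W ((M k).pdf θ)) (law p) := fun θ hθ =>
      (hdens k₀ le_rfl _ (hmono hk.le (hq θ hθ))).2
    have hlt : ∀ θ ∈ (M k).Θ, ∫ x, W ((M k).pdf θ) x ∂(law p) < m := by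
      intro θ hθ
      refine hp.integral_W_lt (hreg k _ (hq θ hθ)) hppos
        (hdens k₀ le_rfl _ (hmono hk.le (hq θ hθ))).1 hW (hint θ hθ) ?_
      intro heq
      exact absurd (hk₀.2 (show p ∈ (M k).densities from heq ▸ hq θ hθ)) (not_le.2 hk)
    obtain ⟨m', hm', hlim⟩ := hL.exists_tendsto_measure hX_indep hX_law hcompact hint hlt
    set η : ℝ := (m - m') / 2 with hη
    have hη0 : 0 < η := by rw [hη]; linarith
    have hlln := tendsto_measure_average hX_indep hX_law (measurable_W p) hW hη0
    have hCcmp : ∀ᶠ n in atTop, C n k * m' < C n k₀ * (m - η) := by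
      have h1 := (hC_one k).mul_const m'
      have h2 := (hC_one k₀).mul_const (m - η)
      exact h1.eventually_lt h2 (by rw [hη]; linarith)
    have hsum := hlim.add hlln
    rw [add_zero] at hsum
    refine tendsto_of_tendsto_of_tendsto_of_le_of_le' tendsto_const_nhds hsum
      (Eventually.of_forall fun _ => zero_le) ?_
    filter_upwards [hCcmp, hCpos k, hCpos k₀] with n hn hn1 hn2
    refine (measure_mono ?_).trans (measure_union_le _ _)
    intro ω hω
    by_contra hnot
    obtain ⟨h1, h2⟩ := not_or.1 hnot
    have h1' : (M k).gic X n ω (θhat k n ω) < m' := by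
      by_contra h
      exact h1 ⟨θhat k n ω, (hθhat k n ω).1, not_lt.1 h⟩
    have h2' : ¬ η ≤ |(1 / (n : ℝ)) * ∑ i ∈ Finset.range n, W p (X i ω) - m| := h2
    rw [← hGIC, not_le, abs_lt] at h2'
    have h3 := (hθhat k₀).gic_le hθ₀ n ω
    have h4 := hkhat n ω k₀
    rw [show khat n ω = k from hω] at h4
    simp only [mic] at h4
    have h5 : C n k * (M k).gic X n ω (θhat k n ω) ≤ C n k * m' := by gcongr
    have h6 : C n k₀ * (m - η) ≤ C n k₀ * (M k₀).gic X n ω (θhat k₀ n ω) := by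
      gcongr
      linarith [h2'.1]
    linarith
  have hoverfit : ∀ k, k₀ < k → Tendsto (fun n => μ {ω | khat n ω = k}) atTop (𝓝 0) := by
    intro k hk
    obtain ⟨hid, hpos, -, hlip, -, hroot, -⟩ := hover k hk.le
    have hmpos : 0 < m := by
      rcases d.eq_zero_or_pos with rfl | hd
      · obtain ⟨q, hqk, hqk₀⟩ := Set.exists_of_ssubset (hnested hk)
        have h1 := hp.integral_W_lt (hreg k q hqk) hppos (hdens k hk.le q hqk).1 hW
          (hdens k hk.le q hqk).2 (fun h => hqk₀ (h ▸ hk₀.1))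
        simp [W_eq_sum] at h1
      · exact hp.integral_W_pos hppos hW ⟨0, hd⟩
    have hlln := tendsto_measure_average hX_indep hX_law (measurable_W p) hW (half_pos hmpos)
    rw [ENNReal.tendsto_nhds_zero]
    intro ε hε
    have hε2 : 0 < ε / 2 := ENNReal.half_pos hε.ne'
    obtain ⟨A, hA⟩ := eventually_measure_gic_gt_le hX_indep hX_law hW (hreg k) (hθhat k) hid hpos
      hlip hroot hε2
    filter_upwards [hA, hlln.eventually (ge_mem_nhds hε2), hCpos k, hCpos k₀,
      eventually_gt_atTop 0, (hC_log k k₀ hk).eventually (eventually_lt_atBot 0),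
      (hC_log k k₀ hk).eventually (eventually_lt_atBot (-(A / (m / 2))))]
      with n hAn hln hn1 hn2 hn hlog0 hlog
    have hn' : (0 : ℝ) < n := by exact_mod_cast hn
    refine le_trans (measure_mono ?_) ((measure_union_le _ _).trans
      ((add_le_add hAn hln).trans (ENNReal.add_halves ε).le))
    intro ω hω
    by_contra hnot
    obtain ⟨h1, h2⟩ := not_or.1 hnot
    have h1' : (n : ℝ) * ((M k).gic X n ω (θhat k n ω) - (M k).gic X n ω (θstar k)) ≤ A :=
      not_lt.1 h1
    have hsame : (M k).gic X n ω (θstar k) = (M k₀).gic X n ω (θstar k₀) := by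
      rw [hGIC, ParametricModel.gic, hid.2.1]
    rw [hsame] at h1'
    have h2' : ¬ m / 2 ≤ |(1 / (n : ℝ)) * ∑ i ∈ Finset.range n, W p (X i ω) - m| := h2
    rw [← hGIC, not_le, abs_lt] at h2'
    have h3 := (hθhat k₀).gic_le hθ₀ n ω
    have h4 := hkhat n ω k₀
    rw [show khat n ω = k from hω] at h4
    simp only [mic] at h4
    have h5 := mul_lt_mul_of_log_div_lt hn' hn1 hn2 (half_pos hmpos)
      (by linarith [h2'.1]) h1' hlog0 hlog
    have h6 := mul_le_mul_of_nonneg_left h3 hn2.le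
    linarith
  intro ε hε
  have hsum : Tendsto (fun n => ∑ k ∈ Finset.univ.erase k₀, μ {ω | khat n ω = k}) atTop (𝓝 0) := by
    rw [show (0 : ENNReal) = ∑ _k ∈ Finset.univ.erase k₀, 0 by simp]
    refine tendsto_finsetSum _ fun k hk => ?_
    rcases lt_or_gt_of_ne (Finset.ne_of_mem_erase hk) with h | h
    · exact hunderfit k h
    · exact hoverfit k h
  refine tendsto_of_tendsto_of_tendsto_of_le_of_le tendsto_const_nhds hsum (fun _ => zero_le)
    fun n => ?_
  refine (measure_mono ?_).trans (measure_biUnion_finset_le _ _)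
  intro ω hω
  refine Set.mem_iUnion₂.2 ⟨khat n ω, Finset.mem_erase.2 ⟨fun h => ?_, Finset.mem_univ _⟩, rfl⟩
  have hω' : ε ≤ edist (((khat n ω : ℕ) : ℝ)) ((k₀ : ℕ) : ℝ) := hω
  rw [h, edist_self] at hω'
  exact absurd hε (not_lt.2 hω')
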